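/- Let $n\ge 2$ be an integer and let $\alpha,\beta>1$ be real. Let $Q\in C^\infty([1,\alpha],\mathbb{R}_{\ge 0})$ with $Q(y)=0$ if and only if $y\in\{1,\alpha\}$. Consider classical solutions $f:[1,\beta]\times[0,\infty)\to[1,\alpha]$ (that is, $f,f_x,f_{xx},f_t$ exist and are continuous on $[1,\beta]\times[0,\infty)$) of $$\frac{\partial f}{\partial t}=Q(f)\Big[\frac{\partial^2 f}{\partial x^2}+(n-1)\frac{1}{x}\frac{\partial f}{\partial x}-(n-1)\frac{f}{x^2}\Big],\qquad f(1,t)=1,\quad f(\beta,t)=\alpha\quad(t\ge 0),$$ whose initial value $f(\cdot,0)$ is strictly increasing on $[1,\beta]$. There is a function $f_\infty:[1,\beta]\to\mathbb{R}$, depending only on $n,\alpha,\beta$ (not on $Q$ or on the initial value), such that for every such solution $f(\cdot,t)\to f_\infty$ uniformly on $[1,\beta]$ as $t\to\infty$. Put $$\tilde f(x)=ax+\frac{b}{x^{n-1}},\qquad a=\frac{\alpha\beta^{n-1}-1}{\beta^n-1},\qquad b=\frac{\beta^n-\alpha\beta^{n-1}}{\beta^n-1}.$$ 1. If $\alpha>\beta$,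 then $f_\infty=\tilde f$ on $[1,\beta]$. 2. If $\alpha<\beta$ and $\frac{\alpha\beta^{n-1}-1}{\beta^n-1}>\frac{n-1}{n}$, then $f_\infty=\tilde f$ on $[1,\beta]$. 3. If $\alpha<\beta$ and $\frac{\alpha\beta^{n-1}-1}{\beta^n-1}=\frac{n-1}{n}$, then $f_\infty=\tilde f$ on $[1,\beta]$. 4. If $\alpha<\beta$ and $\frac{\alpha\beta^{n-1}-1}{\beta^n-1}<\frac{n-1}{n}$, let $\lambda$ be the infimum of all $\lambda'\in[1,\beta]$ for which there is a solution $g\ge 1$ on $[\lambda',\beta]$ of $$g''+(n-1)\frac{g'}{x}-(n-1)\frac{g}{x^2}=0$$ with $g(\lambda')=1$ and $g(\beta)=\alpha$. This infimum is attained, $1<\lambda<\beta$, and the unique solution $g$ of this equation on $[\lambda,\beta]$ with $g(\lambda)=1$, $g(\beta)=\alpha$ satisfies $g'(\lambda)=0$. Then $f_\infty=1$ on $[1,\lambda]$ and $f_\infty=g$ on $[\lambda,\beta]$. -/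

import Mathlib

open Set Filter Topology
open scoped ContDiff

/-- The coefficient `Q ∈ C^∞([1,α], ℝ≥0)`, vanishing exactly at the two endpoints. -/
structure IsDegenerateCoefficient (α : ℝ) (Q : ℝ → ℝ) : Prop where
  smooth : ContDiffOn ℝ ∞ Q (Icc 1 α)
  nonneg : ∀ y ∈ Icc 1 α, 0 ≤ Q y
  zero_iff : ∀ y ∈ Icc 1 α, (Q y = 0 ↔ y = 1 ∨ y = α)

/-- `f x t` is a classical solution on `[1,β] × [0,∞)` of
`∂f/∂t = Q(f) [f'' + (n-1) f'/x - (n-1) f/x²]`, `f(1,t) = 1`, `f(β,t) = α`, with values in the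
domain `[1,α]` of `Q`: the derivatives `f_x`, `f_xx`, `f_t` exist and, like `f`, are continuous up
to the boundary (one-sided derivatives at the boundary). -/
structure IsClassicalSolution (n : ℕ) (α β : ℝ) (Q : ℝ → ℝ) (f : ℝ → ℝ → ℝ) : Prop where
  range : ∀ x ∈ Icc 1 β, ∀ t ∈ Ici (0 : ℝ), f x t ∈ Icc 1 α
  left : ∀ t ∈ Ici (0 : ℝ), f 1 t = 1
  right : ∀ t ∈ Ici (0 : ℝ), f β t = α
  cont : ContinuousOn (fun p : ℝ × ℝ => f p.1 p.2) (Icc 1 β ×ˢ Ici 0)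
  equation : ∃ fx fxx ft : ℝ → ℝ → ℝ,
    ContinuousOn (fun p : ℝ × ℝ => fx p.1 p.2) (Icc 1 β ×ˢ Ici 0) ∧
    ContinuousOn (fun p : ℝ × ℝ => fxx p.1 p.2) (Icc 1 β ×ˢ Ici 0) ∧
    ContinuousOn (fun p : ℝ × ℝ => ft p.1 p.2) (Icc 1 β ×ˢ Ici 0) ∧
    ∀ x ∈ Icc 1 β, ∀ t ∈ Ici (0 : ℝ),
      HasDerivWithinAt (fun y => f y t) (fx x t) (Icc 1 β) x ∧
      HasDerivWithinAt (fun y => fx y t) (fxx x t) (Icc 1 β) x ∧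
      HasDerivWithinAt (fun s => f x s) (ft x t) (Ici 0) t ∧
      ft x t = Q (f x t) *
        (fxx x t + ((n : ℝ) - 1) * fx x t / x - ((n : ℝ) - 1) * f x t / x ^ 2)

/-- `g` solves `g'' + (n-1) g'/x - (n-1) g/x² = 0` on the interval `[l,β]`. -/
def SolvesODE (n : ℕ) (l β : ℝ) (g : ℝ → ℝ) : Prop :=
  ∃ g₁ g₂ : ℝ → ℝ, ∀ x ∈ Icc l β,
    HasDerivWithinAt g (g₁ x) (Icc l β) x ∧
    HasDerivWithinAt g₁ (g₂ x) (Icc l β) x ∧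
    g₂ x + ((n : ℝ) - 1) * g₁ x / x - ((n : ℝ) - 1) * g x / x ^ 2 = 0

/-- The solution `ax + b/x^(n-1)` of the ODE with boundary values `1` at `1` and `α` at `β`. -/
noncomputable def odeProfile (n : ℕ) (α β : ℝ) (x : ℝ) : ℝ :=
  (α * β ^ (n - 1) - 1) / (β ^ n - 1) * x +
    (β ^ n - α * β ^ (n - 1)) / (β ^ n - 1) / x ^ (n - 1)

/-- The points `l ∈ [1,β]` for which some solution `g ≥ 1` of the ODE on `[l,β]` has `g(l) = 1`
and `g(β) = α`. -/
def admissiblePoints (n : ℕ) (α β : ℝ) : Set ℝ :=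
  {l | l ∈ Icc 1 β ∧ ∃ g : ℝ → ℝ, SolvesODE n l β g ∧ g l = 1 ∧ g β = α ∧
    ∀ x ∈ Icc l β, 1 ≤ g x}

/-!
Let `L` be the radial operator, `k = n - 1` and `ω = x ^ k`; then `ω L v = (ω v')' - k x^(k-2) v`.
For a stationary profile `F` and `c > 0` take the Lyapunov functional `∫ ω Φ(x, v)`, where
`∂Φ/∂v = (v - F - c)₊³ / Q(v)`. The degenerate factor cancels along `v_t = Q(v) L v`, so its
derivative is `∫ ω (v - F - c)₊³ L v`; integrating by parts against the weak inequality `L F ≤ 0`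
and using Sobolev's inequality bounds this by `-κ max (v - F - c)₊⁴`. As the functional is
nonnegative, `v ≤ F + 2 c` at some time; from then on this persists, because the functional with
`2 c` in place of `c` starts from zero and is nonincreasing. Applied to `v` and to `-v`, this gives
uniform convergence.

The profile equals `1` up to a contact point `l` and `a x + b / x ^ k` after it. Either `l = 1` or
the junction is `C¹`; hence `L F` is a function, equal to `-k / x² ≤ 0` on the contact set and to
`0` off it. Thus `F` is a supersolution, and `-F` is one when tested off the contact set. That
suffices for the lower bound, as `v ≥ 1` forces the excess of `-v` over `-F` to vanish there.
-/

/-! ### One-variable calculus -/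

theorem hasDerivAt_max_zero_pow (n : ℕ) (y : ℝ) :
    HasDerivAt (fun z : ℝ => max z 0 ^ (n + 2)) ((n + 2) * max y 0 ^ (n + 1)) y := by
  rcases lt_trichotomy y 0 with hy | rfl | hy
  · have h : (fun z : ℝ => max z 0 ^ (n + 2)) =ᶠ[𝓝 y] fun _ => 0 := by
      filter_upwards [Iio_mem_nhds hy] with z hz
      simp [max_eq_right (mem_Iio.1 hz).le]
    simpa [max_eq_right hy.le] using (hasDerivAt_const y (0 : ℝ)).congr_of_eventuallyEq h
  · have h : (fun z : ℝ => max z 0 ^ (n + 2)) =O[𝓝 0] fun z => ‖z - 0‖ ^ (n + 2) := by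
      refine Asymptotics.IsBigO.of_bound 1 (Eventually.of_forall fun z => ?_)
      rw [sub_zero, one_mul, norm_pow, norm_pow, norm_norm]
      gcongr
      rcases le_total z 0 with hz | hz <;> simp [hz]
    simpa using (h.hasFDerivAt (by omega)).hasDerivAt
  · have h : (fun z : ℝ => max z 0 ^ (n + 2)) =ᶠ[𝓝 y] fun z => z ^ (n + 2) := by
      filter_upwards [Ioi_mem_nhds hy] with z hz
      simp [max_eq_left (mem_Ioi.1 hz).le]
    simpa [max_eq_left hy.le] using (hasDerivAt_pow (n + 2) y).congr_of_eventuallyEq h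

theorem hasDerivAt_pow_of_ne_zero (k : ℕ) {x : ℝ} (hx : x ≠ 0) :
    HasDerivAt (fun x : ℝ => x ^ k) (k / x * x ^ k) x := by
  refine (hasDerivAt_pow k x).congr_deriv ?_
  rcases k with _ | k
  · simp
  · rw [Nat.add_sub_cancel, pow_succ]
    field_simp

theorem sq_integral_le_mul_integral_sq {f : ℝ → ℝ} {a b : ℝ} (hab : a ≤ b)
    (hf : ContinuousOn f (Icc a b)) :
    (∫ x in a..b, f x) ^ 2 ≤ (b - a) * ∫ x in a..b, f x ^ 2 := by
  rcases hab.eq_or_lt with rfl | hlt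
  · simp
  have hfi := hf.intervalIntegrable_of_Icc (μ := MeasureTheory.volume) hab
  have hf2i : IntervalIntegrable (fun x => f x ^ 2) MeasureTheory.volume a b :=
    (hf.pow 2).intervalIntegrable_of_Icc hab
  have hba : 0 < b - a := sub_pos.2 hlt
  set s := (∫ x in a..b, f x) / (b - a) with hs
  have hvar : 0 ≤ ∫ x in a..b, (f x - s) ^ 2 :=
    intervalIntegral.integral_nonneg hab fun x _ => sq_nonneg _
  have hexpand : ∫ x in a..b, (f x - s) ^ 2 =
      (∫ x in a..b, f x ^ 2) - 2 * s * (∫ x in a..b, f x) + (b - a) * s ^ 2 := by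
    have hpt : ∀ x, (f x - s) ^ 2 = f x ^ 2 - 2 * s * f x + s ^ 2 := fun x => by ring
    simp only [hpt]
    rw [intervalIntegral.integral_add (hf2i.sub (hfi.const_mul _)) intervalIntegrable_const,
      intervalIntegral.integral_sub hf2i (hfi.const_mul _), intervalIntegral.integral_const_mul,
      intervalIntegral.integral_const, smul_eq_mul]
  have hmean : ∫ x in a..b, f x = (b - a) * s := by
    rw [hs]
    field_simp
  rw [hexpand, hmean] at hvar
  rw [hmean]
  nlinarith [mul_nonneg hba.le hvar]

theorem sq_le_mul_integral_deriv_sq {p p' : ℝ → ℝ} {a b x : ℝ}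
    (hp : ∀ y ∈ Icc a b, HasDerivWithinAt p (p' y) (Icc a b) y) (hp' : ContinuousOn p' (Icc a b))
    (ha : p a = 0) (hx : x ∈ Icc a b) :
    p x ^ 2 ≤ (b - a) * ∫ y in a..b, p' y ^ 2 := by
  have hsub : Icc a x ⊆ Icc a b := Icc_subset_Icc_right hx.2
  have hpx : ∫ y in a..x, p' y = p x := by
    rw [intervalIntegral.integral_eq_sub_of_hasDerivAt_of_le hx.1
      (fun y hy => ((hp y (hsub hy)).continuousWithinAt).mono hsub)
      (fun y hy => (hp y (hsub (Ioo_subset_Icc_self hy))).hasDerivAt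
        (Icc_mem_nhds hy.1 (hy.2.trans_le hx.2)))
      ((hp'.mono hsub).intervalIntegrable_of_Icc hx.1), ha, sub_zero]
  calc p x ^ 2 ≤ (x - a) * ∫ y in a..x, p' y ^ 2 :=
        hpx ▸ sq_integral_le_mul_integral_sq hx.1 (hp'.mono hsub)
    _ ≤ (b - a) * ∫ y in a..b, p' y ^ 2 := by
        refine mul_le_mul (sub_le_sub_right hx.2 a) ?_
          (intervalIntegral.integral_nonneg hx.1 fun y _ => sq_nonneg _)
          (sub_nonneg.2 (hx.1.trans hx.2))
        exact intervalIntegral.integral_mono_interval le_rfl hx.1 hx.2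
          (Eventually.of_forall fun y => sq_nonneg (p' y))
          ((hp'.pow 2).intervalIntegrable_of_Icc (hx.1.trans hx.2))

-- Sobolev's inequality for the square of the positive part, which is a `C¹` function.
theorem max_zero_pow_four_le_mul_integral {u u' : ℝ → ℝ} {a b x : ℝ}
    (hu : ∀ y ∈ Icc a b, HasDerivWithinAt u (u' y) (Icc a b) y) (hu' : ContinuousOn u' (Icc a b))
    (ha : u a ≤ 0) (hx : x ∈ Icc a b) :
    max (u x) 0 ^ 4 ≤ 4 * (b - a) * ∫ y in a..b, (max (u y) 0 * u' y) ^ 2 := by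
  have huc : ContinuousOn u (Icc a b) := fun y hy => (hu y hy).continuousWithinAt
  have hp : ∀ y ∈ Icc a b, HasDerivWithinAt (fun z => max (u z) 0 ^ 2)
      (2 * (max (u y) 0 * u' y)) (Icc a b) y := fun y hy =>
    ((hasDerivAt_max_zero_pow 0 (u y)).comp_hasDerivWithinAt y (hu y hy)).congr_deriv
      (by push_cast; ring)
  have h := sq_le_mul_integral_deriv_sq hp (by fun_prop) (by simp [ha]) hx
  simp only [mul_pow _ (max _ _ * _), intervalIntegral.integral_const_mul] at h
  linarith [pow_mul (max (u x) 0) 2 2]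

theorem lt_of_deriv_eq_mul {R y ℓ : ℝ → ℝ} {B C : ℝ} (hℓ : ContinuousOn ℓ (Ici 0))
    (hy : ∀ t ∈ Ici (0 : ℝ), HasDerivWithinAt y (R (y t) * ℓ t) (Ici 0) t)
    (hR : ∀ t ∈ Ici (0 : ℝ), |R (y t)| ≤ C * (B - y t)) (h0 : y 0 < B) {T : ℝ} (hT : 0 ≤ T) :
    y T < B := by
  obtain ⟨K, hK⟩ := isCompact_Icc.exists_bound_of_continuousOn
    (hℓ.mono (Icc_subset_Ici_self : Icc 0 T ⊆ Ici 0))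
  have hspeed : ∀ t ∈ Icc 0 T, R (y t) * ℓ t ≤ C * K * (B - y t) := fun t ht => by
    calc R (y t) * ℓ t ≤ |R (y t)| * ‖ℓ t‖ := (le_abs_self _).trans_eq (abs_mul _ _)
      _ ≤ C * (B - y t) * K :=
          mul_le_mul (hR t ht.1) (hK t ht) (norm_nonneg _) ((abs_nonneg _).trans (hR t ht.1))
      _ = C * K * (B - y t) := by ring
  have hmono : MonotoneOn (fun t => Real.exp (C * K * t) * (B - y t)) (Icc 0 T) := by
    refine monotoneOn_of_hasDerivWithinAt_nonneg (convex_Icc 0 T)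
      (f' := fun t => Real.exp (C * K * t) * (C * K * (B - y t) - R (y t) * ℓ t)) ?_ ?_ ?_
    · have hyc : ContinuousOn y (Icc 0 T) := fun t ht =>
        ((hy t ht.1).continuousWithinAt).mono Icc_subset_Ici_self
      fun_prop
    · intro t ht
      rw [interior_Icc] at ht
      have hd := (hy t ht.1.le).hasDerivAt (Ici_mem_nhds ht.1)
      have he : HasDerivAt (fun t => Real.exp (C * K * t)) (Real.exp (C * K * t) * (C * K)) t := by
        simpa using ((hasDerivAt_id t).const_mul (C * K)).exp
      refine ((he.mul (hd.const_sub B)).congr_deriv ?_).hasDerivWithinAt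
      ring
    · exact fun t ht =>
        mul_nonneg (Real.exp_pos _).le (sub_nonneg.2 (hspeed t (interior_subset ht)))
  have h : B - y 0 ≤ Real.exp (C * K * T) * (B - y T) := by
    simpa using hmono ⟨le_rfl, hT⟩ ⟨hT, le_rfl⟩ hT
  exact sub_pos.1 (pos_of_mul_pos_right ((sub_pos.2 h0).trans_le h) (Real.exp_pos _).le)

theorem continuousOn_intervalIntegral_of_continuousOn_prod {K : ℝ → ℝ → ℝ} {a b S T : ℝ}
    (hab : a ≤ b) (hST : S ≤ T)
    (hK : ContinuousOn (fun p : ℝ × ℝ => K p.1 p.2) (Icc a b ×ˢ Icc S T)) :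
    ContinuousOn (fun x => ∫ t in S..T, K x t) (Icc a b) := by
  have hc : Continuous (Function.uncurry fun x t : ℝ =>
      K (projIcc a b hab x) (projIcc S T hST t)) := by
    refine hK.comp_continuous (f := fun p : ℝ × ℝ =>
      ((projIcc a b hab p.1 : ℝ), (projIcc S T hST p.2 : ℝ))) ?_ fun p =>
        ⟨(projIcc a b hab p.1).2, (projIcc S T hST p.2).2⟩
    exact (continuous_subtype_val.comp (continuous_projIcc.comp continuous_fst)).prodMk
      (continuous_subtype_val.comp (continuous_projIcc.comp continuous_snd))
  refine (intervalIntegral.continuous_parametric_intervalIntegral_of_continuous'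
    (μ := MeasureTheory.volume) hc S T).continuousOn.congr fun x hx => ?_
  refine intervalIntegral.integral_congr fun t ht => ?_
  rw [uIcc_of_le hST] at ht
  simp only [projIcc_of_mem hab hx, projIcc_of_mem hST ht]

theorem intervalIntegral_swap_of_continuousOn_prod {K : ℝ → ℝ → ℝ} {a b S T : ℝ}
    (hab : a ≤ b) (hST : S ≤ T)
    (hK : ContinuousOn (fun p : ℝ × ℝ => K p.1 p.2) (Icc a b ×ˢ Icc S T)) :
    ∫ x in a..b, ∫ t in S..T, K x t = ∫ t in S..T, ∫ x in a..b, K x t := by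
  refine MeasureTheory.intervalIntegral_intervalIntegral_swap ?_
  rw [uIoc_of_le hab, uIoc_of_le hST]
  exact (hK.integrableOn_compact (isCompact_Icc.prod isCompact_Icc)).mono_set
    (prod_mono Ioc_subset_Icc_self Ioc_subset_Icc_self)

/-! ### Degenerate coefficients and the truncated potential -/

/-- A diffusion coefficient that is positive on `(A, B)` and vanishes at least linearly at `A` and
at `B`; this keeps the solutions of `v_t = R(v) L v` from reaching `A` or `B` in finite time. -/
structure IsLinearlyDegenerate (A B : ℝ) (R : ℝ → ℝ) : Prop where
  continuousOn : ContinuousOn R (Ioo A B)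
  pos : ∀ y ∈ Ioo A B, 0 < R y
  abs_le : ∃ C, ∀ y ∈ Icc A B, |R y| ≤ C * (y - A) ∧ |R y| ≤ C * (B - y)

theorem IsLinearlyDegenerate.comp_neg {A B : ℝ} {R : ℝ → ℝ} (hR : IsLinearlyDegenerate A B R) :
    IsLinearlyDegenerate (-B) (-A) fun y => R (-y) where
  continuousOn := hR.continuousOn.comp continuous_neg.continuousOn fun _ hy =>
    ⟨lt_neg_of_lt_neg hy.2, neg_lt_of_neg_lt hy.1⟩
  pos y hy := hR.pos (-y) ⟨lt_neg_of_lt_neg hy.2, neg_lt_of_neg_lt hy.1⟩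
  abs_le := by
    obtain ⟨C, hC⟩ := hR.abs_le
    refine ⟨C, fun y hy => ?_⟩
    obtain ⟨hA, hB⟩ := hC (-y) ⟨le_neg_of_le_neg hy.2, neg_le_of_neg_le hy.1⟩
    exact ⟨hB.trans_eq (by ring), hA.trans_eq (by ring)⟩

theorem IsDegenerateCoefficient.isLinearlyDegenerate {α : ℝ} {Q : ℝ → ℝ}
    (hQ : IsDegenerateCoefficient α Q) : IsLinearlyDegenerate 1 α Q where
  continuousOn := hQ.smooth.continuousOn.mono Ioo_subset_Icc_self
  pos y hy := (hQ.nonneg y (Ioo_subset_Icc_self hy)).lt_of_ne' fun h =>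
    ((hQ.zero_iff y (Ioo_subset_Icc_self hy)).1 h).elim hy.1.ne' hy.2.ne
  abs_le := by
    obtain ⟨C, hC⟩ := hQ.smooth.exists_lipschitzOnWith (by simp) (convex_Icc 1 α) isCompact_Icc
    refine ⟨C, fun y hy => ?_⟩
    have hα : 1 ≤ α := hy.1.trans hy.2
    have h1 := hC.dist_le_mul y hy 1 ⟨le_rfl, hα⟩
    have h2 := hC.dist_le_mul y hy α ⟨hα, le_rfl⟩
    rw [(hQ.zero_iff 1 ⟨le_rfl, hα⟩).2 (Or.inl rfl), Real.dist_eq, Real.dist_eq, sub_zero,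
      abs_of_nonneg (sub_nonneg.2 hy.1)] at h1
    rw [(hQ.zero_iff α ⟨hα, le_rfl⟩).2 (Or.inr rfl), Real.dist_eq, Real.dist_eq, sub_zero,
      abs_sub_comm y, abs_of_nonneg (sub_nonneg.2 hy.2)] at h2
    exact ⟨h1, h2⟩

/-- The primitive of `(r - m)₊³ / R(r)` that vanishes at `m`. Its derivative along `v_t = R(v) L v`
is `(v - m)₊³ L v`, in which the coefficient no longer appears. -/
noncomputable def truncatedPotential (R : ℝ → ℝ) (m s : ℝ) : ℝ :=
  ∫ r in m..s, max (r - m) 0 ^ 3 / R r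

section truncatedPotential

variable {R : ℝ → ℝ} {A B m : ℝ}

theorem continuousOn_max_sub_zero_cube_div (hR : ContinuousOn R (Ioo A B))
    (hpos : ∀ y ∈ Ioo A B, 0 < R y) (hAm : A < m) :
    ContinuousOn (fun r => max (r - m) 0 ^ 3 / R r) (Iio B) := by
  intro r hrB
  refine ContinuousAt.continuousWithinAt ?_
  rcases lt_or_ge A r with hAr | hrA
  · have hRr : ContinuousAt R r := hR.continuousAt (Ioo_mem_nhds hAr hrB)
    have hne : R r ≠ 0 := (hpos r ⟨hAr, hrB⟩).ne'
    fun_prop (disch := assumption)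
  · have hzero : (fun r => max (r - m) 0 ^ 3 / R r) =ᶠ[𝓝 r] fun _ => 0 := by
      filter_upwards [Iio_mem_nhds (hrA.trans_lt hAm)] with z hz
      simp [max_eq_right (sub_nonpos.2 (mem_Iio.1 hz).le)]
    exact continuousAt_const.congr hzero.symm

theorem intervalIntegrable_max_sub_zero_cube_div (hR : ContinuousOn R (Ioo A B))
    (hpos : ∀ y ∈ Ioo A B, 0 < R y) (hAm : A < m) (hmB : m < B) {s : ℝ} (hs : s < B) :
    IntervalIntegrable (fun r => max (r - m) 0 ^ 3 / R r) MeasureTheory.volume m s :=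
  ((continuousOn_max_sub_zero_cube_div hR hpos hAm).mono
    (fun _ hr => hr.2.trans_lt (max_lt hmB hs))).intervalIntegrable

theorem hasDerivAt_truncatedPotential (hR : ContinuousOn R (Ioo A B))
    (hpos : ∀ y ∈ Ioo A B, 0 < R y) (hAm : A < m) (hmB : m < B) {s : ℝ} (hs : s < B) :
    HasDerivAt (truncatedPotential R m) (max (s - m) 0 ^ 3 / R s) s := by
  have hc := continuousOn_max_sub_zero_cube_div hR hpos hAm
  exact intervalIntegral.integral_hasDerivAt_right
    (intervalIntegrable_max_sub_zero_cube_div hR hpos hAm hmB hs)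
    (hc.stronglyMeasurableAtFilter isOpen_Iio s hs) (hc.continuousAt (Iio_mem_nhds hs))

theorem truncatedPotential_of_le {s : ℝ} (hs : s ≤ m) : truncatedPotential R m s = 0 := by
  refine intervalIntegral.integral_zero_ae (Eventually.of_forall fun r hr => ?_)
  rw [uIoc_of_ge hs] at hr
  simp [max_eq_right (sub_nonpos.2 hr.2)]

theorem truncatedPotential_pos (hR : ContinuousOn R (Ioo A B))
    (hpos : ∀ y ∈ Ioo A B, 0 < R y) (hAm : A < m) {s : ℝ} (hms : m < s)
    (hs : s < B) : 0 < truncatedPotential R m s := by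
  refine intervalIntegral.intervalIntegral_pos_of_pos_on
    (intervalIntegrable_max_sub_zero_cube_div hR hpos hAm (hms.trans hs) hs) (fun r hr => ?_) hms
  exact div_pos (pow_pos (lt_max_of_lt_left (sub_pos.2 hr.1)) 3)
    (hpos r ⟨hAm.trans hr.1, hr.2.trans hs⟩)

theorem truncatedPotential_nonneg (hR : ContinuousOn R (Ioo A B))
    (hpos : ∀ y ∈ Ioo A B, 0 < R y) (hAm : A < m) {s : ℝ} (hs : s < B) :
    0 ≤ truncatedPotential R m s := by
  rcases le_or_gt s m with h | h
  · exact (truncatedPotential_of_le h).ge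
  · exact (truncatedPotential_pos hR hpos hAm h hs).le

theorem exists_truncatedPotential_le (hR : ContinuousOn R (Ioo A B))
    (hpos : ∀ y ∈ Ioo A B, 0 < R y) {c M : ℝ} (hc : 0 < c) (hM : M < B) :
    ∃ C, 0 ≤ C ∧ ∀ m s, A + c ≤ m → s ≤ M → truncatedPotential R m s ≤ C := by
  have hsub : Icc (A + c) M ⊆ Ioo A B := fun r hr =>
    ⟨(lt_add_of_pos_right A hc).trans_le hr.1, hr.2.trans_lt hM⟩
  obtain ⟨K, hK⟩ := isCompact_Icc.exists_bound_of_continuousOn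
    (f := fun r => (r - A) ^ 3 / R r) (s := Icc (A + c) M)
    (ContinuousOn.div (by fun_prop) (hR.mono hsub) fun r hr => (hpos r (hsub hr)).ne')
  refine ⟨|K| * |M - (A + c)|, by positivity, fun m s hm hs => ?_⟩
  rcases le_or_gt s m with h | h
  · rw [truncatedPotential_of_le h]
    positivity
  have hbound : ∀ r ∈ uIoc m s, ‖max (r - m) 0 ^ 3 / R r‖ ≤ |K| := fun r hr => by
    rw [uIoc_of_le h.le] at hr
    have hr' : r ∈ Icc (A + c) M := ⟨hm.trans hr.1.le, hr.2.trans hs⟩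
    have hRr := hpos r (hsub hr')
    have hle : max (r - m) 0 ≤ r - A := max_le (by linarith) (by linarith [hr'.1])
    calc ‖max (r - m) 0 ^ 3 / R r‖ = max (r - m) 0 ^ 3 / R r :=
          Real.norm_of_nonneg (by positivity)
      _ ≤ (r - A) ^ 3 / R r := by gcongr
      _ ≤ |K| := (le_abs_self _).trans ((hK r hr').trans (le_abs_self K))
  calc truncatedPotential R m s ≤ |K| * |s - m| :=
        (le_abs_self _).trans (intervalIntegral.norm_integral_le_of_norm_le_const hbound)
    _ ≤ |K| * |M - (A + c)| := by
        rw [abs_of_pos (sub_pos.2 h), abs_of_nonneg (by linarith : 0 ≤ M - (A + c))]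
        gcongr

theorem integral_max_sub_zero_cube_mul_eq_sub (hR : ContinuousOn R (Ioo A B))
    (hpos : ∀ y ∈ Ioo A B, 0 < R y) (hAm : A < m) (hmB : m < B) {y ℓ : ℝ → ℝ}
    {S T : ℝ} (hST : S ≤ T) (hℓ : ContinuousOn ℓ (Icc S T))
    (hy : ∀ t ∈ Icc S T, HasDerivWithinAt y (R (y t) * ℓ t) (Icc S T) t)
    (hyB : ∀ t ∈ Icc S T, y t < B) :
    ∫ t in S..T, max (y t - m) 0 ^ 3 * ℓ t =
      truncatedPotential R m (y T) - truncatedPotential R m (y S) := by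
  have hyc : ContinuousOn y (Icc S T) := fun t ht => (hy t ht).continuousWithinAt
  refine intervalIntegral.integral_eq_sub_of_hasDerivAt_of_le hST
    (f := fun t => truncatedPotential R m (y t)) (fun t ht => ?_) (fun t ht => ?_) ?_
  · exact (hasDerivAt_truncatedPotential hR hpos hAm hmB
      (hyB t ht)).continuousAt.comp_continuousWithinAt (hyc t ht)
  · have ht' : t ∈ Icc S T := Ioo_subset_Icc_self ht
    refine ((hasDerivAt_truncatedPotential hR hpos hAm hmB (hyB t ht')).comp t
      ((hy t ht').hasDerivAt (Icc_mem_nhds ht.1 ht.2))).congr_deriv ?_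
    rcases le_or_gt (y t) m with h | h
    · simp [max_eq_right (sub_nonpos.2 h)]
    · have := (hpos (y t) ⟨hAm.trans h, hyB t ht'⟩).ne'
      field_simp
  · exact ContinuousOn.intervalIntegrable_of_Icc hST (by fun_prop)

end truncatedPotential

/-! ### Sturm–Liouville operators -/

/-- The operator `L v = v'' + d v' - p v` on `[a, b]`, with drift `d` and potential `p ≥ 0`,
together with a positive weight `ω` such that `ω' = d ω`, that is, `ω L v = (ω v')' - p ω v`. -/
structure SturmLiouville (a b : ℝ) where
  drift : ℝ → ℝ
  potential : ℝ → ℝ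
  weight : ℝ → ℝ
  continuousOn_drift : ContinuousOn drift (Icc a b)
  continuousOn_potential : ContinuousOn potential (Icc a b)
  potential_nonneg : ∀ x ∈ Icc a b, 0 ≤ potential x
  weight_pos : ∀ x ∈ Icc a b, 0 < weight x
  hasDerivWithinAt_weight :
    ∀ x ∈ Icc a b, HasDerivWithinAt weight (drift x * weight x) (Icc a b) x

namespace SturmLiouville

variable {a b : ℝ} (L : SturmLiouville a b)

/-- The value of `L v` at `x`, given `v x`, `v' x` and `v'' x`. -/
def apply (x y y' y'' : ℝ) : ℝ := y'' + L.drift x * y' - L.potential x * y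

/-- `F`, with continuous derivative `F'`, satisfies `L F ≤ 0` in the weak sense on `{F < B}`: it is
tested against nonnegative `C¹` functions that vanish at `a`, at `b` and wherever `B ≤ F`. -/
structure IsWeakSupersolution (B : ℝ) (F F' : ℝ → ℝ) : Prop where
  hasDerivWithinAt : ∀ x ∈ Icc a b, HasDerivWithinAt F (F' x) (Icc a b) x
  continuousOn_deriv : ContinuousOn F' (Icc a b)
  integral_nonneg : ∀ q q' : ℝ → ℝ,
    (∀ x ∈ Icc a b, HasDerivWithinAt q (q' x) (Icc a b) x) → ContinuousOn q' (Icc a b) →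
    (∀ x ∈ Icc a b, 0 ≤ q x) → q a = 0 → q b = 0 → (∀ x ∈ Icc a b, B ≤ F x → q x = 0) →
    0 ≤ ∫ x in a..b, L.weight x * (q' x * F' x + L.potential x * q x * F x)

variable {L}

theorem IsWeakSupersolution.continuousOn {B : ℝ} {F F' : ℝ → ℝ}
    (hF : L.IsWeakSupersolution B F F') : ContinuousOn F (Icc a b) :=
  fun x hx => (hF.hasDerivWithinAt x hx).continuousWithinAt

variable (L)

theorem continuousOn_weight : ContinuousOn L.weight (Icc a b) :=
  fun x hx => (L.hasDerivWithinAt_weight x hx).continuousWithinAt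

theorem exists_pos_le_weight (hab : a ≤ b) : ∃ m, 0 < m ∧ ∀ x ∈ Icc a b, m ≤ L.weight x := by
  obtain ⟨z, hz, hmin⟩ := isCompact_Icc.exists_isMinOn (nonempty_Icc.2 hab) L.continuousOn_weight
  exact ⟨L.weight z, L.weight_pos z hz, fun x hx => hmin hx⟩

theorem integral_weight_mul_apply (hab : a ≤ b) {q q' v v' v'' : ℝ → ℝ}
    (hq : ∀ x ∈ Icc a b, HasDerivWithinAt q (q' x) (Icc a b) x) (hq' : ContinuousOn q' (Icc a b))
    (hv : ∀ x ∈ Icc a b, HasDerivWithinAt v (v' x) (Icc a b) x)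
    (hv' : ∀ x ∈ Icc a b, HasDerivWithinAt v' (v'' x) (Icc a b) x)
    (hv'' : ContinuousOn v'' (Icc a b)) :
    ∫ x in a..b, L.weight x * (q x * L.apply x (v x) (v' x) (v'' x)) =
      q b * (L.weight b * v' b) - q a * (L.weight a * v' a) -
        ∫ x in a..b, L.weight x * (q' x * v' x + L.potential x * q x * v x) := by
  have hqc : ContinuousOn q (Icc a b) := fun x hx => (hq x hx).continuousWithinAt
  have hvc : ContinuousOn v (Icc a b) := fun x hx => (hv x hx).continuousWithinAt
  have hv'c : ContinuousOn v' (Icc a b) := fun x hx => (hv' x hx).continuousWithinAt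
  have hω := L.continuousOn_weight
  have hd := L.continuousOn_drift
  have hp := L.continuousOn_potential
  have hflux : ∀ x ∈ Icc a b, HasDerivWithinAt (fun x => q x * (L.weight x * v' x))
      (L.weight x * (q x * L.apply x (v x) (v' x) (v'' x)) +
        L.weight x * (q' x * v' x + L.potential x * q x * v x)) (Icc a b) x := fun x hx => by
    refine ((hq x hx).mul ((L.hasDerivWithinAt_weight x hx).mul (hv' x hx))).congr_deriv ?_
    simp only [apply, Pi.mul_apply]
    ring
  have hleft : ContinuousOn (fun x => L.weight x * (q x * L.apply x (v x) (v' x) (v'' x)))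
      (Icc a b) := by
    simp only [apply]
    fun_prop
  have hright : ContinuousOn
      (fun x => L.weight x * (q' x * v' x + L.potential x * q x * v x)) (Icc a b) := by
    fun_prop
  have hsum := intervalIntegral.integral_eq_sub_of_hasDerivAt_of_le hab
    (fun x hx => (hflux x hx).continuousWithinAt)
    (fun x hx => (hflux x (Ioo_subset_Icc_self hx)).hasDerivAt (Icc_mem_nhds hx.1 hx.2))
    ((hleft.add hright).intervalIntegrable_of_Icc hab)
  rw [intervalIntegral.integral_add (hleft.intervalIntegrable_of_Icc hab)
    (hright.intervalIntegrable_of_Icc hab)] at hsum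
  exact eq_sub_of_add_eq hsum

variable {L}

theorem IsWeakSupersolution.integral_mul_apply_le {B : ℝ} {q q' v v' v'' F F' : ℝ → ℝ}
    (hF : L.IsWeakSupersolution B F F') (hab : a ≤ b)
    (hv : ∀ x ∈ Icc a b, HasDerivWithinAt v (v' x) (Icc a b) x)
    (hv' : ∀ x ∈ Icc a b, HasDerivWithinAt v' (v'' x) (Icc a b) x)
    (hv'' : ContinuousOn v'' (Icc a b)) (hvB : ∀ x ∈ Icc a b, v x ≤ B) (ha : v a ≤ F a)
    (hb : v b ≤ F b) (hq : ∀ x ∈ Icc a b, HasDerivWithinAt q (q' x) (Icc a b) x)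
    (hq' : ContinuousOn q' (Icc a b)) (hq_nonneg : ∀ x ∈ Icc a b, 0 ≤ q x)
    (hq_zero : ∀ x ∈ Icc a b, v x ≤ F x → q x = 0) :
    ∫ x in a..b, L.weight x * (q x * L.apply x (v x) (v' x) (v'' x)) ≤
      -∫ x in a..b, L.weight x * (q' x * (v' x - F' x)) := by
  have hvc : ContinuousOn v (Icc a b) := fun x hx => (hv x hx).continuousWithinAt
  have hv'c : ContinuousOn v' (Icc a b) := fun x hx => (hv' x hx).continuousWithinAt
  have hqc : ContinuousOn q (Icc a b) := fun x hx => (hq x hx).continuousWithinAt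
  have hFc := hF.continuousOn
  have hF'c := hF.continuousOn_deriv
  have hω := L.continuousOn_weight
  have hp := L.continuousOn_potential
  have hqa := hq_zero a (left_mem_Icc.2 hab) ha
  have hqb := hq_zero b (right_mem_Icc.2 hab) hb
  have htest := hF.integral_nonneg q q' hq hq' hq_nonneg hqa hqb
    fun x hx hBF => hq_zero x hx ((hvB x hx).trans hBF)
  have hpoint : ∀ x ∈ Icc a b,
      L.weight x * (q' x * F' x + L.potential x * q x * F x) +
          L.weight x * (q' x * (v' x - F' x)) ≤
        L.weight x * (q' x * v' x + L.potential x * q x * v x) := fun x hx => by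
    have hω0 := (L.weight_pos x hx).le
    have hp0 := L.potential_nonneg x hx
    have hexcess : 0 ≤ q x * (v x - F x) := by
      rcases le_total (v x) (F x) with h | h
      · rw [hq_zero x hx h, zero_mul]
      · exact mul_nonneg (hq_nonneg x hx) (sub_nonneg.2 h)
    linear_combination mul_nonneg hω0 (mul_nonneg hp0 hexcess)
  rw [L.integral_weight_mul_apply hab hq hq' hv hv' hv'', hqa, hqb, zero_mul, zero_mul, sub_self,
    zero_sub, neg_le_neg_iff]
  refine (le_add_of_nonneg_left htest).trans ?_
  rw [← intervalIntegral.integral_add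
    (ContinuousOn.intervalIntegrable_of_Icc hab (by fun_prop))
    (ContinuousOn.intervalIntegrable_of_Icc hab (by fun_prop))]
  exact intervalIntegral.integral_mono_on hab
    (ContinuousOn.intervalIntegrable_of_Icc hab (by fun_prop))
    (ContinuousOn.intervalIntegrable_of_Icc hab (by fun_prop)) hpoint

theorem IsWeakSupersolution.integral_cube_excess_mul_apply_le {B c : ℝ} {v v' v'' F F' : ℝ → ℝ}
    (hF : L.IsWeakSupersolution B F F') (hab : a ≤ b) (hc : 0 ≤ c)
    (hv : ∀ x ∈ Icc a b, HasDerivWithinAt v (v' x) (Icc a b) x)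
    (hv' : ∀ x ∈ Icc a b, HasDerivWithinAt v' (v'' x) (Icc a b) x)
    (hv'' : ContinuousOn v'' (Icc a b)) (hvB : ∀ x ∈ Icc a b, v x ≤ B) (ha : v a ≤ F a)
    (hb : v b ≤ F b) :
    ∫ x in a..b, L.weight x * (max (v x - F x - c) 0 ^ 3 * L.apply x (v x) (v' x) (v'' x)) ≤
      -(3 * ∫ x in a..b, L.weight x * (max (v x - F x - c) 0 * (v' x - F' x)) ^ 2) := by
  have hvc : ContinuousOn v (Icc a b) := fun x hx => (hv x hx).continuousWithinAt
  have hv'c : ContinuousOn v' (Icc a b) := fun x hx => (hv' x hx).continuousWithinAt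
  have hFc := hF.continuousOn
  have hF'c := hF.continuousOn_deriv
  have hcube : ∀ x ∈ Icc a b, HasDerivWithinAt (fun x => max (v x - F x - c) 0 ^ 3)
      (3 * max (v x - F x - c) 0 ^ 2 * (v' x - F' x)) (Icc a b) x := fun x hx => by
    have hexcess : HasDerivWithinAt (fun x => v x - F x - c) (v' x - F' x) (Icc a b) x :=
      ((hv x hx).sub (hF.hasDerivWithinAt x hx)).sub_const c
    refine ((hasDerivAt_max_zero_pow 1 (v x - F x - c)).comp_hasDerivWithinAt x
      hexcess).congr_deriv ?_
    norm_num
  refine (hF.integral_mul_apply_le hab hv hv' hv'' hvB ha hb hcube (by fun_prop)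
    (fun x _ => by positivity) fun x _ hle => ?_).trans_eq ?_
  · rw [max_eq_right (by linarith), zero_pow three_ne_zero]
  · rw [← intervalIntegral.integral_const_mul]
    congr! 3
    ring

end SturmLiouville

/-! ### Degenerate flows -/

/-- `v x t`, with space derivatives `vx` and `vxx`, is a classical solution of
`v_t = R(v) L v` on `[a, b] × [0, ∞)` with values in `[A, B]`, whose initial value stays strictly
between `A` and `B` inside `(a, b)`. -/
structure IsFlow {a b : ℝ} (L : SturmLiouville a b) (A B : ℝ) (R : ℝ → ℝ)
    (v vx vxx : ℝ → ℝ → ℝ) : Prop where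
  coeff : IsLinearlyDegenerate A B R
  range : ∀ x ∈ Icc a b, ∀ t ∈ Ici (0 : ℝ), v x t ∈ Icc A B
  initial : ∀ x ∈ Ioo a b, v x 0 ∈ Ioo A B
  cont : ContinuousOn (fun p : ℝ × ℝ => v p.1 p.2) (Icc a b ×ˢ Ici 0)
  cont_x : ContinuousOn (fun p : ℝ × ℝ => vx p.1 p.2) (Icc a b ×ˢ Ici 0)
  cont_xx : ContinuousOn (fun p : ℝ × ℝ => vxx p.1 p.2) (Icc a b ×ˢ Ici 0)
  deriv_x : ∀ x ∈ Icc a b, ∀ t ∈ Ici (0 : ℝ),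
    HasDerivWithinAt (fun y => v y t) (vx x t) (Icc a b) x
  deriv_xx : ∀ x ∈ Icc a b, ∀ t ∈ Ici (0 : ℝ),
    HasDerivWithinAt (fun y => vx y t) (vxx x t) (Icc a b) x
  deriv_t : ∀ x ∈ Icc a b, ∀ t ∈ Ici (0 : ℝ),
    HasDerivWithinAt (fun s => v x s) (R (v x t) * L.apply x (v x t) (vx x t) (vxx x t)) (Ici 0) t

/-- A time-independent weak supersolution `F ≥ A` that lies above `v` at `a` and at `b`. -/
structure IsBarrier {a b : ℝ} (L : SturmLiouville a b) (A B : ℝ) (v : ℝ → ℝ → ℝ)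
    (F F' : ℝ → ℝ) : Prop extends L.IsWeakSupersolution B F F' where
  lower_le : ∀ x ∈ Icc a b, A ≤ F x
  left_le : ∀ t ∈ Ici (0 : ℝ), v a t ≤ F a
  right_le : ∀ t ∈ Ici (0 : ℝ), v b t ≤ F b

/-- The integrand of the Lyapunov functional's evolution, `(v - F - c)₊³ L v`. -/
noncomputable def excessRate {a b : ℝ} (L : SturmLiouville a b) (F : ℝ → ℝ)
    (v vx vxx : ℝ → ℝ → ℝ) (c x t : ℝ) : ℝ :=
  max (v x t - F x - c) 0 ^ 3 * L.apply x (v x t) (vx x t) (vxx x t)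

namespace IsFlow

variable {a b A B c S T : ℝ} {L : SturmLiouville a b} {R F F' : ℝ → ℝ} {v vx vxx : ℝ → ℝ → ℝ}

theorem neg (h : IsFlow L A B R v vx vxx) :
    IsFlow L (-B) (-A) (fun y => R (-y)) (fun x t => -v x t) (fun x t => -vx x t)
      (fun x t => -vxx x t) where
  coeff := h.coeff.comp_neg
  range x hx t ht := ⟨neg_le_neg (h.range x hx t ht).2, neg_le_neg (h.range x hx t ht).1⟩
  initial x hx := ⟨neg_lt_neg (h.initial x hx).2, neg_lt_neg (h.initial x hx).1⟩
  cont := h.cont.neg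
  cont_x := h.cont_x.neg
  cont_xx := h.cont_xx.neg
  deriv_x x hx t ht := (h.deriv_x x hx t ht).neg
  deriv_xx x hx t ht := (h.deriv_xx x hx t ht).neg
  deriv_t x hx t ht := (h.deriv_t x hx t ht).neg.congr_deriv (by
    simp only [SturmLiouville.apply, neg_neg]
    ring)

theorem continuousOn_apply (h : IsFlow L A B R v vx vxx) :
    ContinuousOn (fun p : ℝ × ℝ => L.apply p.1 (v p.1 p.2) (vx p.1 p.2) (vxx p.1 p.2))
      (Icc a b ×ˢ Ici 0) := by
  have hv := h.cont
  have hvx := h.cont_x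
  have hvxx := h.cont_xx
  have hd := L.continuousOn_drift.comp continuousOn_fst
    (fun p (hp : p ∈ Icc a b ×ˢ Ici (0 : ℝ)) => hp.1)
  have hp := L.continuousOn_potential.comp continuousOn_fst
    (fun p (hp : p ∈ Icc a b ×ˢ Ici (0 : ℝ)) => hp.1)
  exact (hvxx.add (hd.mul hvx)).sub (hp.mul hv)

theorem lt (h : IsFlow L A B R v vx vxx) {x t : ℝ} (hx : x ∈ Ioo a b) (ht : 0 ≤ t) :
    v x t < B := by
  have hx' := Ioo_subset_Icc_self hx
  obtain ⟨C, hC⟩ := h.coeff.abs_le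
  exact lt_of_deriv_eq_mul
    (h.continuousOn_apply.comp (f := fun s : ℝ => (x, s)) (by fun_prop) fun s hs => ⟨hx', hs⟩)
    (h.deriv_t x hx') (fun s hs => (hC _ (h.range x hx' s hs)).2) (h.initial x hx).2 ht

theorem continuousOn_excessRate (h : IsFlow L A B R v vx vxx) (hF : ContinuousOn F (Icc a b))
    (c : ℝ) :
    ContinuousOn (fun p : ℝ × ℝ => excessRate L F v vx vxx c p.1 p.2) (Icc a b ×ˢ Ici 0) := by
  have hFp : ContinuousOn (fun p : ℝ × ℝ => F p.1) (Icc a b ×ˢ Ici 0) :=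
    hF.comp continuousOn_fst fun p hp => hp.1
  exact ((((h.cont.sub hFp).sub continuousOn_const).sup continuousOn_const).pow 3).mul
    h.continuousOn_apply

theorem continuousOn_integral_excessRate (h : IsFlow L A B R v vx vxx)
    (hF : ContinuousOn F (Icc a b)) (hab : a ≤ b) (hS : 0 ≤ S) (hST : S ≤ T) :
    ContinuousOn (fun x => ∫ t in S..T, excessRate L F v vx vxx c x t) (Icc a b) :=
  continuousOn_intervalIntegral_of_continuousOn_prod hab hST
    ((h.continuousOn_excessRate hF c).mono (prod_mono subset_rfl fun _ ht => hS.trans ht.1))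

theorem exists_integral_weight_mul_excessRate_le (h : IsFlow L A B R v vx vxx)
    (hF : IsBarrier L A B v F F') (hab : a < b) (hc : 0 ≤ c) :
    ∃ κ, 0 < κ ∧ ∀ x ∈ Icc a b, ∀ t ∈ Ici (0 : ℝ),
      ∫ y in a..b, L.weight y * excessRate L F v vx vxx c y t ≤
        -(κ * max (v x t - F x - c) 0 ^ 4) := by
  obtain ⟨m, hm, hmω⟩ := L.exists_pos_le_weight hab.le
  have hba : 0 < b - a := sub_pos.2 hab
  refine ⟨3 * m / (4 * (b - a)), by positivity, fun x hx t ht => ?_⟩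
  have hslice : ∀ {w : ℝ → ℝ → ℝ}, ContinuousOn (fun p : ℝ × ℝ => w p.1 p.2) (Icc a b ×ˢ Ici 0) →
      ContinuousOn (fun y => w y t) (Icc a b) := fun hw =>
    hw.comp (f := fun y : ℝ => (y, t)) (by fun_prop) fun y hy => ⟨hy, ht⟩
  have hv := hslice h.cont
  have hvx := hslice h.cont_x
  have hFc := hF.continuousOn
  have hF'c := hF.continuousOn_deriv
  have hω := L.continuousOn_weight
  have henergy := hF.integral_cube_excess_mul_apply_le hab.le hc (fun y hy => h.deriv_x y hy t ht)
    (fun y hy => h.deriv_xx y hy t ht) (hslice h.cont_xx) (fun y hy => (h.range y hy t ht).2)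
    (hF.left_le t ht) (hF.right_le t ht)
  have hsobolev : max (v x t - F x - c) 0 ^ 4 ≤
      4 * (b - a) * ∫ y in a..b, (max (v y t - F y - c) 0 * (vx y t - F' y)) ^ 2 :=
    max_zero_pow_four_le_mul_integral (u := fun y => v y t - F y - c)
      (fun y hy => ((h.deriv_x y hy t ht).sub (hF.hasDerivWithinAt y hy)).sub_const c)
      (by fun_prop) (by linarith [hF.left_le t ht]) hx
  have hweight : m * ∫ y in a..b, (max (v y t - F y - c) 0 * (vx y t - F' y)) ^ 2 ≤
      ∫ y in a..b, L.weight y * (max (v y t - F y - c) 0 * (vx y t - F' y)) ^ 2 := by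
    rw [← intervalIntegral.integral_const_mul]
    exact intervalIntegral.integral_mono_on hab.le
      (ContinuousOn.intervalIntegrable_of_Icc hab.le (by fun_prop))
      (ContinuousOn.intervalIntegrable_of_Icc hab.le (by fun_prop))
      fun y hy => mul_le_mul_of_nonneg_right (hmω y hy) (sq_nonneg _)
  refine henergy.trans (neg_le_neg ?_)
  rw [div_mul_eq_mul_div, div_le_iff₀ (by positivity)]
  nlinarith [mul_le_mul_of_nonneg_left hsobolev hm.le, mul_le_mul_of_nonneg_left hweight hba.le]

theorem integral_weight_mul_excessRate_nonpos (h : IsFlow L A B R v vx vxx)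
    (hF : IsBarrier L A B v F F') (hab : a < b) (hc : 0 ≤ c) {t : ℝ} (ht : 0 ≤ t) :
    ∫ x in a..b, L.weight x * excessRate L F v vx vxx c x t ≤ 0 := by
  obtain ⟨κ, hκ, hle⟩ := h.exists_integral_weight_mul_excessRate_le hF hab hc
  exact (hle a (left_mem_Icc.2 hab.le) t ht).trans (neg_nonpos.2 (by positivity))

theorem integral_weight_mul_integral_excessRate_le (h : IsFlow L A B R v vx vxx)
    (hF : ContinuousOn F (Icc a b)) (hab : a ≤ b) (hS : 0 ≤ S) (hST : S ≤ T) {K : ℝ}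
    (hK : ∀ t ∈ Icc S T, ∫ x in a..b, L.weight x * excessRate L F v vx vxx c x t ≤ K) :
    ∫ x in a..b, L.weight x * ∫ t in S..T, excessRate L F v vx vxx c x t ≤ (T - S) * K := by
  have hcont : ContinuousOn
      (fun p : ℝ × ℝ => L.weight p.1 * excessRate L F v vx vxx c p.1 p.2) (Icc a b ×ˢ Icc S T) :=
    ((L.continuousOn_weight.comp continuousOn_fst fun p hp => hp.1).mul
      (h.continuousOn_excessRate hF c)).mono (prod_mono subset_rfl fun _ ht => hS.trans ht.1)
  have hcont' := continuousOn_intervalIntegral_of_continuousOn_prod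
    (K := fun t x => L.weight x * excessRate L F v vx vxx c x t) hST hab
    (hcont.comp continuous_swap.continuousOn fun p hp => ⟨hp.2, hp.1⟩)
  simp only [← intervalIntegral.integral_const_mul]
  rw [intervalIntegral_swap_of_continuousOn_prod
    (K := fun x t => L.weight x * excessRate L F v vx vxx c x t) hab hST hcont, ← smul_eq_mul,
    ← intervalIntegral.integral_const]
  exact intervalIntegral.integral_mono_on hST (hcont'.intervalIntegrable_of_Icc hST)
    intervalIntegrable_const hK

theorem integral_excessRate_eq_zero {x : ℝ} (hle : ∀ t ∈ Icc S T, v x t ≤ F x + c)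
    (hST : S ≤ T) : ∫ t in S..T, excessRate L F v vx vxx c x t = 0 := by
  refine intervalIntegral.integral_zero_ae (Eventually.of_forall fun t ht => ?_)
  rw [uIoc_of_le hST] at ht
  have hvF : v x t - F x - c ≤ 0 := by linarith [hle t (Ioc_subset_Icc_self ht)]
  simp [excessRate, hvF]

theorem integral_excessRate_eq_sub (h : IsFlow L A B R v vx vxx) (hc : 0 < c) (hS : 0 ≤ S)
    (hST : S ≤ T) {x : ℝ} (hx : x ∈ Ioo a b) (hA : A ≤ F x) (hB : F x + c < B) :
    ∫ t in S..T, excessRate L F v vx vxx c x t =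
      truncatedPotential R (F x + c) (v x T) - truncatedPotential R (F x + c) (v x S) := by
  have hx' := Ioo_subset_Icc_self hx
  have hsub : Icc S T ⊆ Ici 0 := fun t ht => hS.trans ht.1
  rw [← integral_max_sub_zero_cube_mul_eq_sub h.coeff.continuousOn h.coeff.pos (by linarith) hB
    hST (y := fun t => v x t) (ℓ := fun t => L.apply x (v x t) (vx x t) (vxx x t))
    (h.continuousOn_apply.comp (f := fun t : ℝ => (x, t)) (by fun_prop)
      fun t ht => ⟨hx', hsub ht⟩)
    (fun t ht => (h.deriv_t x hx' t (hsub ht)).mono hsub) (fun t ht => h.lt hx (hsub ht))]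
  simp only [excessRate, sub_sub]

theorem le_barrier_or (h : IsFlow L A B R v vx vxx) (hF : IsBarrier L A B v F F') (hc : 0 ≤ c)
    {x : ℝ} (hx : x ∈ Icc a b) :
    (∀ t ∈ Ici (0 : ℝ), v x t ≤ F x + c) ∨ (x ∈ Ioo a b ∧ F x + c < B) := by
  rcases hx.1.eq_or_lt with rfl | hax
  · exact Or.inl fun t ht => (hF.left_le t ht).trans (le_add_of_nonneg_right hc)
  rcases hx.2.eq_or_lt with rfl | hxb
  · exact Or.inl fun t ht => (hF.right_le t ht).trans (le_add_of_nonneg_right hc)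
  rcases lt_or_ge (F x + c) B with hB | hB
  · exact Or.inr ⟨⟨hax, hxb⟩, hB⟩
  · exact Or.inl fun t ht => (h.range x hx t ht).2.trans hB

theorem integral_excessRate_nonneg (h : IsFlow L A B R v vx vxx) (hF : IsBarrier L A B v F F')
    (hc : 0 < c) (hS : 0 ≤ S) (hST : S ≤ T) {x : ℝ} (hx : x ∈ Icc a b) (hle : v x S ≤ F x + c) :
    0 ≤ ∫ t in S..T, excessRate L F v vx vxx c x t := by
  rcases h.le_barrier_or hF hc.le hx with hbelow | ⟨hx', hB⟩
  · exact (integral_excessRate_eq_zero (fun t ht => hbelow t (hS.trans ht.1)) hST).ge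
  · rw [h.integral_excessRate_eq_sub hc hS hST hx' (hF.lower_le x hx) hB,
      truncatedPotential_of_le hle, sub_zero]
    exact truncatedPotential_nonneg h.coeff.continuousOn h.coeff.pos
      (by linarith [hF.lower_le x hx]) (h.lt hx' (hS.trans hST))

theorem integral_excessRate_pos (h : IsFlow L A B R v vx vxx) (hF : IsBarrier L A B v F F')
    (hc : 0 < c) (hS : 0 ≤ S) (hST : S ≤ T) {x : ℝ} (hx : x ∈ Icc a b) (hle : v x S ≤ F x + c)
    (hlt : F x + c < v x T) : 0 < ∫ t in S..T, excessRate L F v vx vxx c x t := by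
  rcases h.le_barrier_or hF hc.le hx with hbelow | ⟨hx', hB⟩
  · exact absurd (hbelow T (hS.trans hST)) hlt.not_ge
  · rw [h.integral_excessRate_eq_sub hc hS hST hx' (hF.lower_le x hx) hB,
      truncatedPotential_of_le hle, sub_zero]
    exact truncatedPotential_pos h.coeff.continuousOn h.coeff.pos
      (by linarith [hF.lower_le x hx]) hlt (h.lt hx' (hS.trans hST))

theorem le_barrier_of_le (h : IsFlow L A B R v vx vxx) (hF : IsBarrier L A B v F F') (hab : a < b)
    (hc : 0 < c) (hS : 0 ≤ S) (hST : S ≤ T) (hle : ∀ x ∈ Icc a b, v x S ≤ F x + c) :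
    ∀ x ∈ Icc a b, v x T ≤ F x + c := by
  by_contra! hex
  obtain ⟨x, hx, hlt⟩ := hex
  have hpos : 0 < ∫ x in a..b, L.weight x * ∫ t in S..T, excessRate L F v vx vxx c x t :=
    intervalIntegral.integral_pos hab
      (L.continuousOn_weight.mul (h.continuousOn_integral_excessRate hF.continuousOn hab.le hS hST))
      (fun y hy => mul_nonneg (L.weight_pos y (Ioc_subset_Icc_self hy)).le
        (h.integral_excessRate_nonneg hF hc hS hST (Ioc_subset_Icc_self hy)
          (hle y (Ioc_subset_Icc_self hy))))
      ⟨x, hx, mul_pos (L.weight_pos x hx)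
        (h.integral_excessRate_pos hF hc hS hST hx (hle x hx) hlt)⟩
  have hnonpos := h.integral_weight_mul_integral_excessRate_le hF.continuousOn hab.le hS hST
    fun t ht => h.integral_weight_mul_excessRate_nonpos hF hab hc.le (hS.trans ht.1)
  exact absurd hpos (hnonpos.trans_eq (mul_zero _)).not_gt

theorem exists_lt_forall_initial_le (h : IsFlow L A B R v vx vxx) (hF : IsBarrier L A B v F F')
    (hc : 0 < c) : ∃ M < B, ∀ x ∈ Icc a b, F x + c ≤ v x 0 → v x 0 ≤ M := by
  have hv0 : ContinuousOn (fun x => v x 0) (Icc a b) :=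
    h.cont.comp (f := fun x : ℝ => (x, (0 : ℝ))) (by fun_prop) fun x hx => ⟨hx, self_mem_Ici⟩
  have hcompact : IsCompact {x ∈ Icc a b | F x + c ≤ v x 0} :=
    isCompact_Icc.of_isClosed_subset
      (isClosed_Icc.isClosed_le (hF.continuousOn.add continuousOn_const) hv0) fun x hx => hx.1
  rcases {x ∈ Icc a b | F x + c ≤ v x 0}.eq_empty_or_nonempty with hempty | hne
  · exact ⟨B - 1, by linarith, fun x hx hle => absurd hempty (Set.Nonempty.ne_empty ⟨x, hx, hle⟩)⟩
  obtain ⟨z, ⟨hz, hzF⟩, hmax⟩ := hcompact.exists_isMaxOn hne (hv0.mono fun x hx => hx.1)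
  have hza : a ≠ z := by
    rintro rfl
    linarith [hF.left_le 0 self_mem_Ici]
  have hzb : z ≠ b := by
    rintro rfl
    linarith [hF.right_le 0 self_mem_Ici]
  exact ⟨v z 0, (h.initial z ⟨hz.1.lt_of_ne hza, hz.2.lt_of_ne hzb⟩).2,
    fun x hx hle => hmax ⟨hx, hle⟩⟩

theorem exists_neg_le_integral_excessRate (h : IsFlow L A B R v vx vxx)
    (hF : IsBarrier L A B v F F') (hc : 0 < c) :
    ∃ C, ∀ T, 0 ≤ T → ∀ x ∈ Icc a b, -C ≤ ∫ t in 0..T, excessRate L F v vx vxx c x t := by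
  obtain ⟨M, hMB, hM⟩ := h.exists_lt_forall_initial_le hF hc
  obtain ⟨C, hC0, hC⟩ := exists_truncatedPotential_le h.coeff.continuousOn h.coeff.pos hc hMB
  refine ⟨C, fun T hT x hx => ?_⟩
  rcases le_or_gt (v x 0) (F x + c) with hle | hlt
  · exact (neg_nonpos.2 hC0).trans (h.integral_excessRate_nonneg hF hc le_rfl hT hx hle)
  rcases h.le_barrier_or hF hc.le hx with hbelow | ⟨hx', hB⟩
  · exact absurd (hbelow 0 self_mem_Ici) hlt.not_ge
  have hA := hF.lower_le x hx
  rw [h.integral_excessRate_eq_sub hc le_rfl hT hx' hA hB]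
  have hinit := hC (F x + c) (v x 0) (by linarith) (hM x hx hlt.le)
  have hfinal := truncatedPotential_nonneg h.coeff.continuousOn h.coeff.pos
    (by linarith : A < F x + c) (h.lt hx' hT)
  linarith

theorem exists_forall_le_barrier (h : IsFlow L A B R v vx vxx) (hF : IsBarrier L A B v F F')
    (hab : a < b) {ε : ℝ} (hε : 0 < ε) :
    ∃ S, 0 ≤ S ∧ ∀ x ∈ Icc a b, v x S ≤ F x + ε := by
  by_contra! hexcess
  obtain ⟨κ, hκ, hdecay⟩ :=
    h.exists_integral_weight_mul_excessRate_le hF hab (c := ε / 2) (by positivity)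
  obtain ⟨C, hC⟩ := h.exists_neg_le_integral_excessRate hF (c := ε / 2) (by positivity)
  have hrate : ∀ t, 0 ≤ t →
      ∫ y in a..b, L.weight y * excessRate L F v vx vxx (ε / 2) y t ≤ -(κ * (ε / 2) ^ 4) :=
    fun t ht => by
      obtain ⟨x, hx, hlt⟩ := hexcess t ht
      have hεx : ε / 2 ≤ max (v x t - F x - ε / 2) 0 := le_max_of_le_left (by linarith)
      exact (hdecay x hx t ht).trans (neg_le_neg (by gcongr))
  have hlower : ∀ T, 0 ≤ T → -C * ∫ x in a..b, L.weight x ≤ T * -(κ * (ε / 2) ^ 4) :=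
    fun T hT => by
      have hupper := h.integral_weight_mul_integral_excessRate_le hF.continuousOn hab.le le_rfl hT
        fun t ht => hrate t ht.1
      rw [sub_zero] at hupper
      refine le_trans ?_ hupper
      rw [← intervalIntegral.integral_const_mul]
      refine intervalIntegral.integral_mono_on hab.le
        ((continuousOn_const.mul L.continuousOn_weight).intervalIntegrable_of_Icc hab.le)
        ((L.continuousOn_weight.mul (h.continuousOn_integral_excessRate hF.continuousOn hab.le
          le_rfl hT)).intervalIntegrable_of_Icc hab.le) fun x hx => ?_
      rw [mul_comm]
      exact mul_le_mul_of_nonneg_left (hC T hT x hx) (L.weight_pos x hx).le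
  obtain ⟨T, hT⟩ := exists_gt (max 0 ((C * ∫ x in a..b, L.weight x) / (κ * (ε / 2) ^ 4)))
  rw [max_lt_iff, div_lt_iff₀ (by positivity)] at hT
  linarith [hlower T hT.1.le, hT.2]

theorem eventually_le_barrier (h : IsFlow L A B R v vx vxx) (hF : IsBarrier L A B v F F')
    (hab : a < b) {ε : ℝ} (hε : 0 < ε) :
    ∀ᶠ t in atTop, ∀ x ∈ Icc a b, v x t ≤ F x + ε := by
  obtain ⟨S, hS, hle⟩ := h.exists_forall_le_barrier hF hab hε
  filter_upwards [eventually_ge_atTop S] with t ht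
  exact h.le_barrier_of_le hF hab hε hS ht hle

theorem tendstoUniformlyOn (h : IsFlow L A B R v vx vxx) (hab : a < b)
    (hF : IsBarrier L A B v F F')
    (hFneg : IsBarrier L (-B) (-A) (fun x t => -v x t) (fun x => -F x) (fun x => -F' x)) :
    TendstoUniformlyOn (fun t x => v x t) F atTop (Icc a b) := by
  refine Metric.tendstoUniformlyOn_iff.2 fun ε hε => ?_
  filter_upwards [h.eventually_le_barrier hF hab (half_pos hε),
    h.neg.eventually_le_barrier hFneg hab (half_pos hε)] with t hupper hlower x hx
  rw [Real.dist_eq, abs_lt]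
  constructor <;> linarith [hupper x hx, hlower x hx]

end IsFlow

/-! ### Radial stationary profiles -/

/-- The operator `L v = v'' + k v' / x - k v / x²` on an interval `[a, b]` with `0 < a`, where
`k = n - 1`; its weight is `x ^ k`. -/
@[simps]
noncomputable def radialOperator (k : ℕ) {a : ℝ} (b : ℝ) (ha : 0 < a) : SturmLiouville a b where
  drift x := k / x
  potential x := k / x ^ 2
  weight x := x ^ k
  continuousOn_drift := continuousOn_const.div continuousOn_id fun _ hx => (ha.trans_le hx.1).ne'
  continuousOn_potential := continuousOn_const.div (continuousOn_pow 2) fun _ hx =>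
    pow_ne_zero 2 (ha.trans_le hx.1).ne'
  potential_nonneg x _ := by positivity
  weight_pos _ hx := pow_pos (ha.trans_le hx.1) k
  hasDerivWithinAt_weight _ hx :=
    (hasDerivAt_pow_of_ne_zero k (ha.trans_le hx.1).ne').hasDerivWithinAt

/-- The general solution `a x + b / x ^ k` of `g'' + k g' / x - k g / x² = 0`. -/
noncomputable def radialSolution (k : ℕ) (a b x : ℝ) : ℝ := a * x + b / x ^ k

/-- The derivative of `radialSolution`. -/
noncomputable def radialSolutionDeriv (k : ℕ) (a b x : ℝ) : ℝ := a - k * b / x ^ (k + 1)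

theorem hasDerivAt_radialSolution (k : ℕ) (a b : ℝ) {x : ℝ} (hx : x ≠ 0) :
    HasDerivAt (radialSolution k a b) (radialSolutionDeriv k a b x) x := by
  have hpow := (hasDerivAt_const x b).div (hasDerivAt_pow_of_ne_zero k hx) (pow_ne_zero k hx)
  refine (((hasDerivAt_id x).const_mul a).add hpow).congr_deriv ?_
  rw [radialSolutionDeriv]
  field_simp
  ring

theorem hasDerivAt_radialSolutionDeriv (k : ℕ) (a b : ℝ) {x : ℝ} (hx : x ≠ 0) :
    HasDerivAt (radialSolutionDeriv k a b)
      (k * radialSolution k a b x / x ^ 2 - k * radialSolutionDeriv k a b x / x) x := by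
  have hpow := (hasDerivAt_const x (k * b)).div (hasDerivAt_pow_of_ne_zero (k + 1) hx)
    (pow_ne_zero (k + 1) hx)
  refine (hpow.const_sub a).congr_deriv ?_
  rw [radialSolutionDeriv, radialSolution]
  push_cast
  field_simp
  ring

theorem radialOperator_apply_radialSolution (k : ℕ) {l β : ℝ} (hl : 0 < l) (a b x : ℝ) :
    (radialOperator k β hl).apply x (radialSolution k a b x) (radialSolutionDeriv k a b x)
      (k * radialSolution k a b x / x ^ 2 - k * radialSolutionDeriv k a b x / x) = 0 := by
  simp only [SturmLiouville.apply, radialOperator_drift, radialOperator_potential]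
  ring

/-- The parameters of a stationary profile: it equals `1` up to the contact point `l` and
`a x + b / x ^ k` from `l` on, with a `C¹` junction if `l` is not the endpoint `1`. -/
structure IsStationaryData (k : ℕ) (α β a b l : ℝ) : Prop where
  one_le : 1 ≤ l
  lt : l < β
  left : radialSolution k a b l = 1
  right : radialSolution k a b β = α
  deriv_nonneg : ∀ x ∈ Icc l β, 0 ≤ radialSolutionDeriv k a b x
  junction : l = 1 ∨ radialSolutionDeriv k a b l = 0

/-- The stationary profile with the given parameters. Under `IsStationaryData` it is constant on
`[1, l]`. -/
noncomputable def stationary (k : ℕ) (a b l x : ℝ) : ℝ := radialSolution k a b (max x l)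

/-- The derivative of `stationary`. -/
noncomputable def stationaryDeriv (k : ℕ) (a b l x : ℝ) : ℝ := radialSolutionDeriv k a b (max x l)

theorem stationary_of_ge {k : ℕ} {a b l x : ℝ} (hx : l ≤ x) :
    stationary k a b l x = radialSolution k a b x := by
  rw [stationary, max_eq_left hx]

theorem stationaryDeriv_of_ge {k : ℕ} {a b l x : ℝ} (hx : l ≤ x) :
    stationaryDeriv k a b l x = radialSolutionDeriv k a b x := by
  rw [stationaryDeriv, max_eq_left hx]

namespace IsStationaryData

variable {k : ℕ} {α β a b l x : ℝ}

theorem one_lt (h : IsStationaryData k α β a b l) : 1 < β := h.one_le.trans_lt h.lt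

theorem stationary_of_le (h : IsStationaryData k α β a b l) (hx : x ≤ l) :
    stationary k a b l x = 1 := by
  rw [stationary, max_eq_right hx, h.left]

theorem stationary_right (h : IsStationaryData k α β a b l) : stationary k a b l β = α := by
  rw [stationary_of_ge h.lt.le, h.right]

theorem stationaryDeriv_of_le (h : IsStationaryData k α β a b l) (hl : 1 < l) (hx : x ≤ l) :
    stationaryDeriv k a b l x = 0 := by
  rw [stationaryDeriv, max_eq_right hx]
  exact h.junction.resolve_left hl.ne'

theorem hasDerivWithinAt_Iic (h : IsStationaryData k α β a b l) (hl : 1 < l) (hx : x ≤ l) :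
    HasDerivWithinAt (stationary k a b l) (stationaryDeriv k a b l x) (Iic l) x := by
  rw [h.stationaryDeriv_of_le hl hx]
  exact (hasDerivWithinAt_const x (Iic l) (1 : ℝ)).congr (fun z hz => h.stationary_of_le hz)
    (h.stationary_of_le hx)

theorem hasDerivWithinAt_Ici (h : IsStationaryData k α β a b l) (hx : l ≤ x) :
    HasDerivWithinAt (stationary k a b l) (stationaryDeriv k a b l x) (Ici l) x := by
  rw [stationaryDeriv_of_ge hx]
  exact (hasDerivAt_radialSolution k a b (by linarith [h.one_le])).hasDerivWithinAt.congr
    (fun z hz => stationary_of_ge hz) (stationary_of_ge hx)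

theorem hasDerivWithinAt (h : IsStationaryData k α β a b l) (hx : x ∈ Icc 1 β) :
    HasDerivWithinAt (stationary k a b l) (stationaryDeriv k a b l x) (Icc 1 β) x := by
  rcases h.one_le.eq_or_lt with rfl | hl
  · exact (h.hasDerivWithinAt_Ici hx.1).mono Icc_subset_Ici_self
  rcases lt_trichotomy x l with hxl | rfl | hxl
  · exact ((h.hasDerivWithinAt_Iic hl hxl.le).hasDerivAt (Iic_mem_nhds hxl)).hasDerivWithinAt
  · exact ((h.hasDerivWithinAt_Iic hl le_rfl).union (h.hasDerivWithinAt_Ici le_rfl)).mono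
      fun z _ => le_total z x
  · exact ((h.hasDerivWithinAt_Ici hxl.le).hasDerivAt (Ici_mem_nhds hxl)).hasDerivWithinAt

theorem continuous_stationaryDeriv (h : IsStationaryData k α β a b l) :
    Continuous (stationaryDeriv k a b l) := by
  have hne : ∀ x : ℝ, max x l ^ (k + 1) ≠ 0 := fun x =>
    pow_ne_zero _ (by linarith [le_max_right x l, h.one_le])
  unfold stationaryDeriv radialSolutionDeriv
  fun_prop (disch := assumption)

theorem monotoneOn (h : IsStationaryData k α β a b l) :
    MonotoneOn (stationary k a b l) (Icc 1 β) := by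
  refine monotoneOn_of_hasDerivWithinAt_nonneg (convex_Icc 1 β)
    (fun x hx => (h.hasDerivWithinAt hx).continuousWithinAt)
    (fun x hx => (h.hasDerivWithinAt (interior_subset hx)).mono interior_subset) fun x hx => ?_
  exact h.deriv_nonneg _ ⟨le_max_right _ _, max_le (interior_subset hx).2 h.lt.le⟩

theorem stationary_mem_Icc (h : IsStationaryData k α β a b l) (hx : x ∈ Icc 1 β) :
    stationary k a b l x ∈ Icc 1 α := by
  rw [← h.stationary_of_le h.one_le, ← h.stationary_right]
  exact ⟨h.monotoneOn (left_mem_Icc.2 h.one_lt.le) hx hx.1,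
    h.monotoneOn hx (right_mem_Icc.2 h.one_lt.le) hx.2⟩

theorem integral_weak_form_right (h : IsStationaryData k α β a b l) {q q' : ℝ → ℝ}
    (hq : ∀ x ∈ Icc 1 β, HasDerivWithinAt q (q' x) (Icc 1 β) x) (hq' : ContinuousOn q' (Icc 1 β))
    (hq1 : q 1 = 0) (hqβ : q β = 0) :
    ∫ x in l..β, x ^ k * (q' x * stationaryDeriv k a b l x +
      k / x ^ 2 * q x * stationary k a b l x) = 0 := by
  have hl0 : 0 < l := one_pos.trans_le h.one_le
  have hsub : Icc l β ⊆ Icc 1 β := Icc_subset_Icc_left h.one_le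
  have hx0 : ∀ x ∈ Icc l β, x ≠ 0 := fun x hx => (hl0.trans_le hx.1).ne'
  have hd : ∀ x ∈ Icc l β, HasDerivWithinAt (radialSolution k a b) (radialSolutionDeriv k a b x)
      (Icc l β) x := fun x hx => (hasDerivAt_radialSolution k a b (hx0 x hx)).hasDerivWithinAt
  have hdd : ∀ x ∈ Icc l β, HasDerivWithinAt (radialSolutionDeriv k a b)
      (k * radialSolution k a b x / x ^ 2 - k * radialSolutionDeriv k a b x / x) (Icc l β) x :=
    fun x hx => (hasDerivAt_radialSolutionDeriv k a b (hx0 x hx)).hasDerivWithinAt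
  have hddc : ContinuousOn (fun x =>
      k * radialSolution k a b x / x ^ 2 - k * radialSolutionDeriv k a b x / x) (Icc l β) := by
    have hc : ContinuousOn (radialSolution k a b) (Icc l β) := fun x hx =>
      (hd x hx).continuousWithinAt
    have hdc : ContinuousOn (radialSolutionDeriv k a b) (Icc l β) := fun x hx =>
      (hdd x hx).continuousWithinAt
    have hx2 : ∀ x ∈ Icc l β, x ^ 2 ≠ 0 := fun x hx => pow_ne_zero 2 (hx0 x hx)
    fun_prop (disch := assumption)
  have hflux : q l * (l ^ k * radialSolutionDeriv k a b l) = 0 := by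
    rcases h.junction with rfl | hl
    · rw [hq1, zero_mul]
    · rw [hl, mul_zero, mul_zero]
  have hparts := (radialOperator k β hl0).integral_weight_mul_apply h.lt.le
    (fun x hx => (hq x (hsub hx)).mono hsub) (hq'.mono hsub) hd hdd hddc
  simp only [radialOperator_apply_radialSolution, mul_zero, intervalIntegral.integral_zero,
    radialOperator_weight, radialOperator_potential, hqβ, zero_mul, hflux, sub_zero, zero_sub,
    zero_eq_neg] at hparts
  rw [← hparts]
  refine intervalIntegral.integral_congr fun x hx => ?_
  rw [uIcc_of_le h.lt.le] at hx
  simp only [stationary_of_ge hx.1, stationaryDeriv_of_ge hx.1]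

theorem integral_weak_form (h : IsStationaryData k α β a b l) {q q' : ℝ → ℝ}
    (hq : ∀ x ∈ Icc 1 β, HasDerivWithinAt q (q' x) (Icc 1 β) x) (hq' : ContinuousOn q' (Icc 1 β))
    (hq1 : q 1 = 0) (hqβ : q β = 0) :
    ∫ x in 1..β, x ^ k * (q' x * stationaryDeriv k a b l x +
        k / x ^ 2 * q x * stationary k a b l x) =
      ∫ x in 1..l, x ^ k * (k / x ^ 2 * q x) := by
  have hqc : ContinuousOn q (Icc 1 β) := fun x hx => (hq x hx).continuousWithinAt
  have hFc : ContinuousOn (stationary k a b l) (Icc 1 β) := fun x hx =>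
    (h.hasDerivWithinAt hx).continuousWithinAt
  have hF'c : ContinuousOn (stationaryDeriv k a b l) (Icc 1 β) :=
    h.continuous_stationaryDeriv.continuousOn
  have hx2 : ∀ x ∈ Icc 1 β, x ^ 2 ≠ 0 := fun x hx => pow_ne_zero 2 (one_pos.trans_le hx.1).ne'
  have hcont : ContinuousOn (fun x => x ^ k * (q' x * stationaryDeriv k a b l x +
      k / x ^ 2 * q x * stationary k a b l x)) (Icc 1 β) := by
    fun_prop (disch := assumption)
  rw [← intervalIntegral.integral_add_adjacent_intervals
    ((hcont.mono (Icc_subset_Icc_right h.lt.le)).intervalIntegrable_of_Icc h.one_le)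
    ((hcont.mono (Icc_subset_Icc_left h.one_le)).intervalIntegrable_of_Icc h.lt.le),
    h.integral_weak_form_right hq hq' hq1 hqβ, add_zero]
  refine intervalIntegral.integral_congr_ae (Eventually.of_forall fun x hx => ?_)
  rw [uIoc_of_le h.one_le] at hx
  rw [h.stationary_of_le hx.2, h.stationaryDeriv_of_le (hx.1.trans_le hx.2) hx.2, mul_zero,
    zero_add, mul_one]

theorem isWeakSupersolution (h : IsStationaryData k α β a b l) (B : ℝ) :
    (radialOperator k β one_pos).IsWeakSupersolution B (stationary k a b l)
      (stationaryDeriv k a b l) where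
  hasDerivWithinAt _ hx := h.hasDerivWithinAt hx
  continuousOn_deriv := h.continuous_stationaryDeriv.continuousOn
  integral_nonneg q q' hq hq' hq0 hq1 hqβ _ := by
    simp only [radialOperator_weight, radialOperator_potential]
    rw [h.integral_weak_form hq hq' hq1 hqβ]
    refine intervalIntegral.integral_nonneg h.one_le fun x hx => ?_
    have hx0 : 0 < x := one_pos.trans_le hx.1
    have hqx := hq0 x ⟨hx.1, hx.2.trans h.lt.le⟩
    positivity

theorem isWeakSupersolution_neg (h : IsStationaryData k α β a b l) :
    (radialOperator k β one_pos).IsWeakSupersolution (-1) (fun x => -stationary k a b l x)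
      (fun x => -stationaryDeriv k a b l x) where
  hasDerivWithinAt _ hx := (h.hasDerivWithinAt hx).neg
  continuousOn_deriv := h.continuous_stationaryDeriv.neg.continuousOn
  integral_nonneg q q' hq hq' _ hq1 hqβ hq0 := by
    simp only [radialOperator_weight, radialOperator_potential, mul_neg, ← neg_add,
      intervalIntegral.integral_neg]
    rw [h.integral_weak_form hq hq' hq1 hqβ, intervalIntegral.integral_zero_ae, neg_zero]
    refine Eventually.of_forall fun x hx => ?_
    rw [uIoc_of_le h.one_le] at hx
    rw [hq0 x ⟨hx.1.le, hx.2.trans h.lt.le⟩ (neg_le_neg (h.stationary_of_le hx.2).le), mul_zero,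
      mul_zero]

end IsStationaryData

/-! ### Convergence of classical solutions -/

namespace IsClassicalSolution

variable {k : ℕ} {α β a b l : ℝ} {Q : ℝ → ℝ} {f : ℝ → ℝ → ℝ}

theorem initial_mem_Ioo {n : ℕ} (hf : IsClassicalSolution n α β Q f)
    (h0 : StrictMonoOn (fun x => f x 0) (Icc 1 β)) : ∀ x ∈ Ioo 1 β, f x 0 ∈ Ioo 1 α :=
  fun x hx => by
    have hβ := hx.1.trans hx.2
    have hx' := Ioo_subset_Icc_self hx
    have hleft := h0 (left_mem_Icc.2 hβ.le) hx' hx.1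
    have hright := h0 hx' (right_mem_Icc.2 hβ.le) hx.2
    simp only [hf.left 0 self_mem_Ici, hf.right 0 self_mem_Ici] at hleft hright
    exact ⟨hleft, hright⟩

theorem exists_isFlow (hf : IsClassicalSolution (k + 1) α β Q f) (hQ : IsLinearlyDegenerate 1 α Q)
    (h0 : ∀ x ∈ Ioo 1 β, f x 0 ∈ Ioo 1 α) :
    ∃ fx fxx, IsFlow (radialOperator k β one_pos) 1 α Q f fx fxx := by
  obtain ⟨fx, fxx, ft, hcx, hcxx, -, hder⟩ := hf.equation
  exact ⟨fx, fxx, {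
    coeff := hQ
    range := hf.range
    initial := h0
    cont := hf.cont
    cont_x := hcx
    cont_xx := hcxx
    deriv_x := fun x hx t ht => (hder x hx t ht).1
    deriv_xx := fun x hx t ht => (hder x hx t ht).2.1
    deriv_t := fun x hx t ht => by
      obtain ⟨-, -, hft, hequation⟩ := hder x hx t ht
      refine hft.congr_deriv (hequation.trans ?_)
      simp only [SturmLiouville.apply, radialOperator_drift, radialOperator_potential]
      push_cast
      ring }⟩

theorem isBarrier (hf : IsClassicalSolution (k + 1) α β Q f) (hd : IsStationaryData k α β a b l) :
    IsBarrier (radialOperator k β one_pos) 1 α f (stationary k a b l)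
      (stationaryDeriv k a b l) where
  toIsWeakSupersolution := hd.isWeakSupersolution α
  lower_le _ hx := (hd.stationary_mem_Icc hx).1
  left_le t ht := by rw [hf.left t ht, hd.stationary_of_le hd.one_le]
  right_le t ht := by rw [hf.right t ht, hd.stationary_right]

theorem isBarrier_neg (hf : IsClassicalSolution (k + 1) α β Q f)
    (hd : IsStationaryData k α β a b l) :
    IsBarrier (radialOperator k β one_pos) (-α) (-1) (fun x t => -f x t)
      (fun x => -stationary k a b l x) (fun x => -stationaryDeriv k a b l x) where
  toIsWeakSupersolution := hd.isWeakSupersolution_neg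
  lower_le _ hx := neg_le_neg (hd.stationary_mem_Icc hx).2
  left_le t ht := by rw [hf.left t ht, hd.stationary_of_le hd.one_le]
  right_le t ht := by rw [hf.right t ht, hd.stationary_right]

theorem tendstoUniformlyOn (hf : IsClassicalSolution (k + 1) α β Q f)
    (hQ : IsLinearlyDegenerate 1 α Q) (h0 : ∀ x ∈ Ioo 1 β, f x 0 ∈ Ioo 1 α)
    (hd : IsStationaryData k α β a b l) :
    TendstoUniformlyOn (fun t x => f x t) (stationary k a b l) atTop (Icc 1 β) := by
  obtain ⟨fx, fxx, hflow⟩ := hf.exists_isFlow hQ h0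
  exact hflow.tendstoUniformlyOn hd.one_lt (hf.isBarrier hd) (hf.isBarrier_neg hd)

end IsClassicalSolution

/-! ### Solutions of the stationary equation -/

theorem solvesODE_radialSolution (k : ℕ) (a b : ℝ) {l β : ℝ} (hl : 0 < l) :
    SolvesODE (k + 1) l β (radialSolution k a b) := by
  refine ⟨radialSolutionDeriv k a b, fun x =>
    k * radialSolution k a b x / x ^ 2 - k * radialSolutionDeriv k a b x / x, fun x hx => ?_⟩
  have hx0 : x ≠ 0 := (hl.trans_le hx.1).ne'
  refine ⟨(hasDerivAt_radialSolution k a b hx0).hasDerivWithinAt,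
    (hasDerivAt_radialSolutionDeriv k a b hx0).hasDerivWithinAt, ?_⟩
  push_cast
  ring

theorem eq_left_of_hasDerivWithinAt_zero {u : ℝ → ℝ} {a b : ℝ}
    (hu : ∀ x ∈ Icc a b, HasDerivWithinAt u 0 (Icc a b) x) : ∀ x ∈ Icc a b, u x = u a :=
  constant_of_has_deriv_right_zero (fun x hx => (hu x hx).continuousWithinAt) fun x hx =>
    (hu x (Ico_subset_Icc_self hx)).mono_of_mem_nhdsWithin (Icc_mem_nhdsGE_of_mem hx)

-- The equation has the two first integrals `h' + k h / x` and `x ^ k h - x ^ (k + 1) h'`, which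
-- determine `h`.
theorem SolvesODE.exists_eqOn_radialSolution {k : ℕ} {l β : ℝ} {h : ℝ → ℝ}
    (hh : SolvesODE (k + 1) l β h) (hl : 0 < l) :
    ∃ a b, EqOn h (radialSolution k a b) (Icc l β) := by
  obtain ⟨h₁, h₂, hd⟩ := hh
  have hx0 : ∀ x ∈ Icc l β, x ≠ 0 := fun x hx => (hl.trans_le hx.1).ne'
  have hslope := eq_left_of_hasDerivWithinAt_zero (u := fun x => h₁ x + k * h x / x) fun x hx => by
    obtain ⟨hd₁, hd₂, hequation⟩ := hd x hx
    refine (hd₂.add ((hd₁.const_mul (k : ℝ)).div (hasDerivWithinAt_id x _)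
      (hx0 x hx))).congr_deriv ?_
    rw [← hequation]
    have := hx0 x hx
    push_cast
    simp only [id]
    field_simp
    ring
  have hpole := eq_left_of_hasDerivWithinAt_zero
      (u := fun x => x ^ k * h x - x ^ (k + 1) * h₁ x) fun x hx => by
    obtain ⟨hd₁, hd₂, hequation⟩ := hd x hx
    refine (((hasDerivAt_pow_of_ne_zero k (hx0 x hx)).hasDerivWithinAt.mul hd₁).sub
      ((hasDerivAt_pow_of_ne_zero (k + 1) (hx0 x hx)).hasDerivWithinAt.mul hd₂)).congr_deriv ?_
    rw [← mul_zero (-x ^ (k + 1)), ← hequation]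
    have := hx0 x hx
    push_cast
    field_simp
    ring
  refine ⟨(h₁ l + k * h l / l) / (k + 1), (l ^ k * h l - l ^ (k + 1) * h₁ l) / (k + 1),
    fun x hx => ?_⟩
  rw [← hslope x hx, ← hpole x hx, radialSolution]
  have := hx0 x hx
  field_simp
  ring

theorem radialSolution_lt_radialSolution_iff {k : ℕ} {a b a' b' x β : ℝ}
    (h : radialSolution k a b β = radialSolution k a' b' β) (hx : 0 < x) (hxβ : x < β) :
    radialSolution k a b x < radialSolution k a' b' x ↔ a' < a := by
  have hβ : 0 < β := hx.trans hxβ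
  have hb : b' - b = (a - a') * β ^ (k + 1) := by
    simp only [radialSolution] at h
    field_simp at h
    linear_combination -h
  have hdiff : radialSolution k a' b' x - radialSolution k a b x =
      (a - a') * ((β ^ (k + 1) - x ^ (k + 1)) / x ^ k) := by
    simp only [radialSolution]
    field_simp
    linear_combination hb
  have hpow : 0 < (β ^ (k + 1) - x ^ (k + 1)) / x ^ k :=
    div_pos (sub_pos.2 (pow_lt_pow_left₀ hxβ hx.le k.succ_ne_zero)) (pow_pos hx k)
  rw [← sub_pos, hdiff, mul_pos_iff_of_pos_right hpow, sub_pos]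

theorem SolvesODE.eqOn {k : ℕ} {l β a b : ℝ} {h : ℝ → ℝ} (hh : SolvesODE (k + 1) l β h)
    (hl : 0 < l) (hlβ : l < β) (hleft : h l = radialSolution k a b l)
    (hright : h β = radialSolution k a b β) : EqOn h (radialSolution k a b) (Icc l β) := by
  obtain ⟨a', b', heq⟩ := hh.exists_eqOn_radialSolution hl
  rw [heq (left_mem_Icc.2 hlβ.le)] at hleft
  rw [heq (right_mem_Icc.2 hlβ.le)] at hright
  obtain rfl : a' = a := le_antisymm
    (not_lt.1 ((radialSolution_lt_radialSolution_iff hright hl hlβ).not.1 hleft.not_lt))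
    (not_lt.1 ((radialSolution_lt_radialSolution_iff hright.symm hl hlβ).not.1 hleft.not_gt))
  obtain rfl : b' = b := by simpa [radialSolution, (hl.trans hlβ).ne'] using hright
  exact heq

/-! ### The contact point -/

theorem radialSolution_div (k : ℕ) (a b x l : ℝ) :
    radialSolution k a b (x / l) = radialSolution k (a / l) (b * l ^ k) x := by
  rw [radialSolution, radialSolution, div_pow, div_div_eq_mul_div]
  ring

theorem radialSolutionDeriv_div (k : ℕ) (a b x : ℝ) {l : ℝ} (hl : l ≠ 0) :
    radialSolutionDeriv k a b (x / l) / l = radialSolutionDeriv k (a / l) (b * l ^ k) x := by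
  rw [radialSolutionDeriv, radialSolutionDeriv, div_pow]
  field_simp
  ring

/-- The radial solution with value `1` and slope `0` at `1`. The solution touching the constant `1`
at `l` is `x ↦ tangentSolution k (x / l)`. -/
noncomputable def tangentSolution (k : ℕ) : ℝ → ℝ := radialSolution k (k / (k + 1)) (1 / (k + 1))

theorem tangentSolution_one (k : ℕ) : tangentSolution k 1 = 1 := by
  rw [tangentSolution, radialSolution]
  field_simp
  simp

theorem radialSolutionDeriv_tangent (k : ℕ) (s : ℝ) :
    radialSolutionDeriv k (k / (k + 1)) (1 / (k + 1)) s = k / (k + 1) * (1 - 1 / s ^ (k + 1)) := by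
  rw [radialSolutionDeriv]
  ring

theorem hasDerivAt_tangentSolution (k : ℕ) {s : ℝ} (hs : s ≠ 0) :
    HasDerivAt (tangentSolution k) (k / (k + 1) * (1 - 1 / s ^ (k + 1))) s :=
  radialSolutionDeriv_tangent k s ▸ hasDerivAt_radialSolution k _ _ hs

theorem one_lt_tangentSolution {k : ℕ} (hk : 1 ≤ k) {s : ℝ} (hs : 0 < s) (hs1 : s < 1) :
    1 < tangentSolution k s := by
  have hanti : StrictAntiOn (tangentSolution k) (Ioc 0 1) := by
    refine strictAntiOn_of_hasDerivWithinAt_neg (convex_Ioc 0 1)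
      (fun x hx => (hasDerivAt_tangentSolution k hx.1.ne').continuousAt.continuousWithinAt)
      (fun x hx => (hasDerivAt_tangentSolution k (interior_subset hx).1.ne').hasDerivWithinAt)
      fun x hx => ?_
    rw [interior_Ioc] at hx
    refine mul_neg_of_pos_of_neg (by positivity) (sub_neg.2 ?_)
    exact one_lt_one_div (pow_pos hx.1 _) (pow_lt_one₀ hx.1.le hx.2 k.succ_ne_zero)
  rw [← tangentSolution_one k]
  exact hanti ⟨hs, hs1.le⟩ (right_mem_Ioc.2 one_pos) hs1

theorem lt_tangentSolution_iff {k : ℕ} {α β : ℝ} (hβ : 1 < β) :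
    α < tangentSolution k β ↔ (α * β ^ k - 1) / (β ^ (k + 1) - 1) < k / (k + 1) := by
  have : 0 < β := one_pos.trans hβ
  have hpow : 0 < β ^ (k + 1) - 1 := sub_pos.2 (one_lt_pow₀ hβ k.succ_ne_zero)
  have hvalue : tangentSolution k β = (k * β ^ (k + 1) + 1) / ((k + 1) * β ^ k) := by
    rw [tangentSolution, radialSolution]
    field_simp
    ring
  rw [hvalue, lt_div_iff₀ (by positivity), div_lt_div_iff₀ hpow (by positivity)]
  constructor <;> intro h <;> linarith

theorem exists_tangentSolution_div_eq {k : ℕ} {α β : ℝ} (hα : 1 < α) (hβ : 1 < β)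
    (hαβ : α < tangentSolution k β) : ∃ l ∈ Ioo 1 β, tangentSolution k (β / l) = α := by
  have hcont : ContinuousOn (fun l => tangentSolution k (β / l)) (Icc 1 β) := fun l hl => by
    have hl0 : 0 < l := one_pos.trans_le hl.1
    have hβl : β / l ≠ 0 := (div_pos (one_pos.trans hβ) hl0).ne'
    exact ((hasDerivAt_tangentSolution k hβl).continuousAt.comp
      (f := fun l => β / l) (continuousAt_const.div continuousAt_id hl0.ne')).continuousWithinAt
  refine intermediate_value_Ioo' hβ.le hcont ?_
  simpa only [div_self (one_pos.trans hβ).ne', div_one, tangentSolution_one] using ⟨hα, hαβ⟩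

theorem isStationaryData_tangent (k : ℕ) {l β : ℝ} (hl : 1 ≤ l) (hlβ : l < β) :
    IsStationaryData k (tangentSolution k (β / l)) β (k / (k + 1) / l) (1 / (k + 1) * l ^ k) l := by
  have hl0 : 0 < l := one_pos.trans_le hl
  refine ⟨hl, hlβ, ?_, ?_, fun x hx => ?_, Or.inr ?_⟩
  · rw [← radialSolution_div, div_self hl0.ne']
    exact tangentSolution_one k
  · rw [← radialSolution_div, tangentSolution]
  · have hxl : 1 ≤ x / l := (one_le_div hl0).2 hx.1
    rw [← radialSolutionDeriv_div k _ _ x hl0.ne', radialSolutionDeriv_tangent]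
    have hpow : 1 / (x / l) ^ (k + 1) ≤ 1 := (div_le_one (by positivity)).2 (one_le_pow₀ hxl)
    have := sub_nonneg.2 hpow
    positivity
  · rw [← radialSolutionDeriv_div k _ _ l hl0.ne', radialSolutionDeriv_tangent, div_self hl0.ne',
      one_pow, div_one, sub_self, mul_zero, zero_div]

theorem isLeast_admissiblePoints {k : ℕ} (hk : 1 ≤ k) {l β : ℝ} (hl : 1 ≤ l) (hlβ : l < β) :
    IsLeast (admissiblePoints (k + 1) (tangentSolution k (β / l)) β) l := by
  have hl0 : 0 < l := one_pos.trans_le hl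
  have hd := isStationaryData_tangent k hl hlβ
  refine ⟨⟨⟨hl, hlβ.le⟩, _, solvesODE_radialSolution k _ _ hl0, hd.left, hd.right, fun x hx => ?_⟩,
    fun l' hl' => ?_⟩
  · rw [← stationary_of_ge hx.1]
    exact (hd.stationary_mem_Icc ⟨hl.trans hx.1, hx.2⟩).1
  · obtain ⟨hl'I, g, hg, hg1, hgβ, hge⟩ := hl'
    by_contra! hlt
    have hl'0 : 0 < l' := one_pos.trans_le hl'I.1
    obtain ⟨a, b, heq⟩ := hg.exists_eqOn_radialSolution hl'0
    rw [heq (left_mem_Icc.2 hl'I.2)] at hg1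
    rw [heq (right_mem_Icc.2 hl'I.2), ← hd.right] at hgβ
    have hbelow : radialSolution k a b l' <
        radialSolution k (k / (k + 1) / l) (1 / (k + 1) * l ^ k) l' := by
      rw [hg1, ← radialSolution_div]
      exact one_lt_tangentSolution hk (div_pos hl'0 hl0) ((div_lt_one hl0).2 hlt)
    have hcontact := (radialSolution_lt_radialSolution_iff hgβ hl0 hlβ).2
      ((radialSolution_lt_radialSolution_iff hgβ hl'0 (hlt.trans hlβ)).1 hbelow)
    rw [hd.left, ← heq ⟨hlt.le, hlβ.le⟩] at hcontact
    exact hcontact.not_ge (hge l ⟨hlt.le, hlβ.le⟩)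

/-! ### The two regimes -/

theorem isStationaryData_odeProfile {k : ℕ} {α β : ℝ} (hβ : 1 < β)
    (hge : (k : ℝ) / (k + 1) ≤ (α * β ^ k - 1) / (β ^ (k + 1) - 1)) :
    IsStationaryData k α β ((α * β ^ k - 1) / (β ^ (k + 1) - 1))
      ((β ^ (k + 1) - α * β ^ k) / (β ^ (k + 1) - 1)) 1 := by
  have hpow : 0 < β ^ (k + 1) - 1 := sub_pos.2 (one_lt_pow₀ hβ k.succ_ne_zero)
  have : 0 < β := one_pos.trans hβ
  set a : ℝ := (α * β ^ k - 1) / (β ^ (k + 1) - 1) with ha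
  have hb : (β ^ (k + 1) - α * β ^ k) / (β ^ (k + 1) - 1) = 1 - a := by
    rw [ha]
    field_simp
    ring
  rw [hb]
  refine ⟨le_rfl, hβ, ?_, ?_, fun x hx => ?_, Or.inl rfl⟩
  · rw [radialSolution, one_pow, mul_one, div_one, add_sub_cancel]
  · rw [radialSolution, ha]
    field_simp
    ring
  · rw [radialSolutionDeriv, sub_nonneg]
    have hx1 : 1 ≤ x ^ (k + 1) := one_le_pow₀ hx.1
    have ha0 : 0 ≤ a := le_trans (by positivity) hge
    rw [div_le_iff₀ (by positivity)] at hge ⊢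
    linarith [mul_le_mul_of_nonneg_left hx1 ha0]

theorem odeProfile_slope_pos {k : ℕ} {α β : ℝ} (hα : 1 < α) (hβ : 1 < β) :
    0 < (α * β ^ k - 1) / (β ^ (k + 1) - 1) :=
  div_pos (sub_pos.2 (one_lt_mul_of_lt_of_le hα (one_le_pow₀ hβ.le)))
    (sub_pos.2 (one_lt_pow₀ hβ k.succ_ne_zero))

theorem lt_of_odeProfile_slope_lt_one {k : ℕ} {α β : ℝ} (hβ : 1 < β)
    (h : (α * β ^ k - 1) / (β ^ (k + 1) - 1) < 1) : α < β := by
  rw [div_lt_one (sub_pos.2 (one_lt_pow₀ hβ k.succ_ne_zero)), sub_lt_sub_iff_right, pow_succ'] at h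
  exact lt_of_mul_lt_mul_right h (by positivity)

theorem exists_contact {k : ℕ} {α β : ℝ} (hα : 1 < α) (hβ : 1 < β)
    (h : (α * β ^ k - 1) / (β ^ (k + 1) - 1) < k / (k + 1)) :
    ∃ a b l, IsStationaryData k α β a b l ∧ IsLeast (admissiblePoints (k + 1) α β) l ∧ 1 < l := by
  have hk : 1 ≤ k := by
    refine Nat.one_le_iff_ne_zero.2 ?_
    rintro rfl
    exact ((odeProfile_slope_pos hα hβ).trans h).ne' (by simp)
  obtain ⟨l, hl, rfl⟩ := exists_tangentSolution_div_eq hα hβ ((lt_tangentSolution_iff hβ).2 h)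
  exact ⟨_, _, l, isStationaryData_tangent k hl.1.le hl.2,
    isLeast_admissiblePoints hk hl.1.le hl.2, hl.1⟩

theorem theorem2_general (n : ℕ) (hn : 1 ≤ n) (α β : ℝ) (hα : 1 < α) (hβ : 1 < β) :
    ∃ F : ℝ → ℝ,
      (∀ Q : ℝ → ℝ, IsLinearlyDegenerate 1 α Q →
        ∀ f : ℝ → ℝ → ℝ, IsClassicalSolution n α β Q f →
          (∀ x ∈ Ioo 1 β, f x 0 ∈ Ioo 1 α) →
          TendstoUniformlyOn (fun t x => f x t) F atTop (Icc 1 β)) ∧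
      (β < α → EqOn F (odeProfile n α β) (Icc 1 β)) ∧
      (α < β → ((n : ℝ) - 1) / n < (α * β ^ (n - 1) - 1) / (β ^ n - 1) →
        EqOn F (odeProfile n α β) (Icc 1 β)) ∧
      (α < β → (α * β ^ (n - 1) - 1) / (β ^ n - 1) = ((n : ℝ) - 1) / n →
        EqOn F (odeProfile n α β) (Icc 1 β)) ∧
      (α < β → (α * β ^ (n - 1) - 1) / (β ^ n - 1) < ((n : ℝ) - 1) / n →
        ∃ (l : ℝ) (g : ℝ → ℝ),
          IsLeast (admissiblePoints n α β) l ∧ 1 < l ∧ l < β ∧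
          SolvesODE n l β g ∧ g l = 1 ∧ g β = α ∧
          (∀ h : ℝ → ℝ, SolvesODE n l β h → h l = 1 → h β = α → EqOn h g (Icc l β)) ∧
          HasDerivWithinAt g 0 (Icc l β) l ∧
          (∀ x ∈ Icc 1 l, F x = 1) ∧ EqOn F g (Icc l β)) := by
  obtain ⟨k, rfl⟩ := Nat.exists_eq_add_of_le' hn
  simp only [Nat.add_sub_cancel, Nat.cast_add, Nat.cast_one, add_sub_cancel_right]
  rcases lt_or_ge ((α * β ^ k - 1) / (β ^ (k + 1) - 1)) ((k : ℝ) / (k + 1)) with hlt | hge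
  · obtain ⟨a, b, l, hd, hleast, hl⟩ := exists_contact hα hβ hlt
    have hl0 : 0 < l := one_pos.trans hl
    have hαβ : α < β := lt_of_odeProfile_slope_lt_one hβ
      (hlt.trans ((div_lt_one (by positivity)).2 (lt_add_one _)))
    refine ⟨stationary k a b l, fun Q hQ f hf h0 => hf.tendstoUniformlyOn hQ h0 hd,
      fun h => absurd h hαβ.not_gt, fun _ h => absurd h hlt.not_gt, fun _ h => absurd h hlt.ne,
      fun _ _ => ⟨l, radialSolution k a b, hleast, hl, hd.lt, solvesODE_radialSolution k a b hl0,
        hd.left, hd.right, fun h hh h1 h2 =>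
          hh.eqOn hl0 hd.lt (h1.trans hd.left.symm) (h2.trans hd.right.symm),
        ?_, fun x hx => hd.stationary_of_le hx.2, fun x hx => stationary_of_ge hx.1⟩⟩
    exact hd.junction.resolve_left hl.ne' ▸
      (hasDerivAt_radialSolution k a b hl0.ne').hasDerivWithinAt
  · have hF : EqOn (stationary k ((α * β ^ k - 1) / (β ^ (k + 1) - 1))
        ((β ^ (k + 1) - α * β ^ k) / (β ^ (k + 1) - 1)) 1) (odeProfile (k + 1) α β) (Icc 1 β) :=
      fun x hx => stationary_of_ge hx.1
    exact ⟨_, fun Q hQ f hf h0 => hf.tendstoUniformlyOn hQ h0 (isStationaryData_odeProfile hβ hge),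
      fun _ => hF, fun _ _ => hF, fun _ _ => hF, fun _ h => absurd h hge.not_gt⟩

theorem theorem2 (n : ℕ) (hn : 2 ≤ n) (α β : ℝ) (hα : 1 < α) (hβ : 1 < β) :
    ∃ F : ℝ → ℝ,
      -- every solution converges uniformly to `F`, whatever the coefficient and the initial value
      (∀ Q : ℝ → ℝ, IsDegenerateCoefficient α Q →
        ∀ f : ℝ → ℝ → ℝ, IsClassicalSolution n α β Q f →
          StrictMonoOn (fun x => f x 0) (Icc 1 β) →
          TendstoUniformlyOn (fun t x => f x t) F atTop (Icc 1 β)) ∧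
      (β < α → EqOn F (odeProfile n α β) (Icc 1 β)) ∧
      (α < β → ((n : ℝ) - 1) / n < (α * β ^ (n - 1) - 1) / (β ^ n - 1) →
        EqOn F (odeProfile n α β) (Icc 1 β)) ∧
      (α < β → (α * β ^ (n - 1) - 1) / (β ^ n - 1) = ((n : ℝ) - 1) / n →
        EqOn F (odeProfile n α β) (Icc 1 β)) ∧
      (α < β → (α * β ^ (n - 1) - 1) / (β ^ n - 1) < ((n : ℝ) - 1) / n →
        ∃ (l : ℝ) (g : ℝ → ℝ),
          IsLeast (admissiblePoints n α β) l ∧ 1 < l ∧ l < β ∧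
          SolvesODE n l β g ∧ g l = 1 ∧ g β = α ∧
          (∀ h : ℝ → ℝ, SolvesODE n l β h → h l = 1 → h β = α → EqOn h g (Icc l β)) ∧
          HasDerivWithinAt g 0 (Icc l β) l ∧
          (∀ x ∈ Icc 1 l, F x = 1) ∧ EqOn F g (Icc l β)) := by
  obtain ⟨F, hF, hprofile⟩ := theorem2_general n (one_le_two.trans hn) α β hα hβ
  exact ⟨F, fun Q hQ f hf h0 => hF Q hQ.isLinearlyDegenerate f hf (hf.initial_mem_Ioo h0), hprofile⟩
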